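/- Let $P\subset\mathbb{R}^3$ be an equilateral polygonal knot: a simple closed polygon with cyclically indexed vertices $v_1,\dots,v_n$ and all edges of length $dl>0$. Let $\theta_i\in[0,\pi]$ be the turning angle of the edge vectors at $v_i$, $\theta_{\max}=\max_i\theta_i$, and $Rad(v_i)=\frac{dl}{2\tan(\theta_i/2)}$ ($=\infty$ if $\theta_i=0$, $=0$ if $\theta_i=\pi$). Put $$MinRad(P)=\min_i Rad(v_i)=\frac{dl}{2\tan(\theta_{\max}/2)},\qquad R_s(P)=\min\Bigl\{\sqrt{MinRad(P)^2+(dl/2)^2},\ SR(P)\Bigr\},$$ where $SR(P)$ is half the minimum distance between vertices $v_i,v_j$ whose index distance $\min(|i-j|,\,n-|i-j|)$ is at least $\lceil \pi\,MinRad(P)/dl-1\rceil$, and put $R_c(P)=\sqrt{R_s(P)^2-dl^2/4}$. Let $K_P$ be the closed curve obtained by replacing, at each vertex $v_i$, the corner between the midpoints of the two adjacent edges by the circular arc of radius $Rad(v_i)$ tangent to the two edges at these midpoints (by the straight segment if $\theta_i=0$). For a $C^1$ knot $K$ let $D_r(x)$ be the disk of radius $r$ centred at $x\in K$ in the plane normal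 to $K$ at $x$. The thickness radius is $R(K)=\sup\{r>0: D_r(x)\cap D_r(y)=\emptyset \text{ for all } x\ne y\in K\}$ (and $0$ if there is no such $r$), and the ropelength is $Rope(K)=Length(K)/R(K)$ (and $\infty$ if $R(K)=0$). Theorem. If $R_s(P)>dl/\sqrt2$, then: 1. $K_P$ is a $C^{1,1}$ knot (in particular it is simple), and its thickness radius satisfies $R(K_P)\ge R_c(P)$; 2. $K_P$ is ambient isotopic to $P$; 3. $Rope(K_P)\le Length(K_P)/R_c(P)$, and consequently the minimal ropelength of the knot type of $P$ (the infimum of $Rope(K)$ over all $C^1$ knots $K$ ambient isotopic to $P$) is at most $Length(K_P)/R_c(P)$. -/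

import Mathlib

open scoped ENNReal RealInnerProductSpace

noncomputable section

namespace Ropelength

/-- Euclidean three-space. -/
abbrev E3 : Type := EuclideanSpace ℝ (Fin 3)

/-! ### Smooth knots -/

/-- `γ` is a regular `C¹` parametrization, with period `L`, of a `C¹` knot: a simple closed
curve in `ℝ³`. -/
structure IsC1Knot (γ : ℝ → E3) (L : ℝ) : Prop where
  period_pos : 0 < L
  periodic : Function.Periodic γ L
  contDiff : ContDiff ℝ 1 γ
  regular : ∀ s, deriv γ s ≠ 0
  injOn : Set.InjOn γ (Set.Ico 0 L)

/-- A `C^{1,1}` knot: a `C¹` knot whose derivative is Lipschitz. -/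
def IsC11Knot (γ : ℝ → E3) (L : ℝ) : Prop :=
  IsC1Knot γ L ∧ ∃ C : NNReal, LipschitzWith C (deriv γ)

/-- The disk `D_r(x)` of radius `r` centred at `x = γ s` in the plane normal to the curve. -/
def normalDisk (γ : ℝ → E3) (r s : ℝ) : Set E3 :=
  {p | dist p (γ s) ≤ r ∧ ⟪deriv γ s, p - γ s⟫ = 0}

/-- The thickness radius: the supremum of all `r > 0` for which the normal disks of radius `r`
at distinct points of the curve are disjoint. It is taken in `[0, ∞]`, so it is `0` if there is
no such `r`. -/
def thickness (γ : ℝ → E3) (L : ℝ) : ℝ≥0∞ :=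
  sSup (ENNReal.ofReal '' {r : ℝ | 0 < r ∧
    ∀ s ∈ Set.Ico 0 L, ∀ t ∈ Set.Ico 0 L, s ≠ t →
      Disjoint (normalDisk γ r s) (normalDisk γ r t)})

/-- The arclength of a `C¹` closed curve of period `L`. -/
def length (γ : ℝ → E3) (L : ℝ) : ℝ := ∫ s in (0 : ℝ)..L, ‖deriv γ s‖

/-- The ropelength, length over thickness radius; it is `∞` for a knot of thickness `0`. -/
def ropelength (γ : ℝ → E3) (L : ℝ) : ℝ≥0∞ :=
  ENNReal.ofReal (length γ L) / thickness γ L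

/-- `A` and `B` are ambient isotopic in `ℝ³` (have the same knot type). -/
def AmbientIsotopic (A B : Set E3) : Prop :=
  ∃ H : unitInterval → (E3 ≃ₜ E3),
    Continuous (fun p : unitInterval × E3 => H p.1 p.2) ∧
    H 0 = Homeomorph.refl E3 ∧ H 1 '' A = B

/-- The minimal ropelength of the knot type of `A`: the infimum of the ropelengths of all
`C¹` knots that are ambient isotopic to `A`. -/
def minRopelength (A : Set E3) : ℝ≥0∞ :=
  sInf {ρ | ∃ (γ : ℝ → E3) (L : ℝ), IsC1Knot γ L ∧ AmbientIsotopic A (Set.range γ) ∧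
    ρ = ropelength γ L}

/-! ### Equilateral polygonal knots -/

/-- An equilateral polygonal knot with `n` vertices, indexed cyclically, and edge length `dl`.
The last field says that the closed polygon is simple: its standard parametrization by
`(edge, position in the edge)` is injective (which forces `3 ≤ n`). -/
structure EquilateralKnot (n : ℕ) [NeZero n] where
  vertex : ZMod n → E3
  dl : ℝ
  dl_pos : 0 < dl
  dist_vertex : ∀ i, dist (vertex i) (vertex (i + 1)) = dl
  simple : ∀ i j : ZMod n, ∀ s ∈ Set.Ico (0 : ℝ) 1, ∀ t ∈ Set.Ico (0 : ℝ) 1,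
    AffineMap.lineMap (vertex i) (vertex (i + 1)) s =
      (AffineMap.lineMap (vertex j) (vertex (j + 1)) t : E3) → i = j ∧ s = t

namespace EquilateralKnot

variable {n : ℕ} [NeZero n] (P : EquilateralKnot n)

/-- The polygon as a subset of space. -/
def carrier : Set E3 := ⋃ i, segment ℝ (P.vertex i) (P.vertex (i + 1))

/-- The edge vector from `v_i` to `v_{i+1}`. -/
def edge (i : ZMod n) : E3 := P.vertex (i + 1) - P.vertex i

/-- The turning angle at `v_i`, in `[0, π]`. -/
def turningAngle (i : ZMod n) : ℝ := InnerProductGeometry.angle (P.edge (i - 1)) (P.edge i)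

/-- The maximal turning angle. -/
def maxTurningAngle : ℝ := ⨆ i, P.turningAngle i

/-- The radius of the circular arc inscribed at `v_i`. It is used only where the turning angle
is not zero (at a straight vertex the radius is infinite). -/
def rad (i : ZMod n) : ℝ := P.dl / (2 * Real.tan (P.turningAngle i / 2))

/-- `MinRad(P)`, the smallest of the radii of the inscribed arcs, which is the one at a vertex
of maximal turning angle. -/
def minRad : ℝ := P.dl / (2 * Real.tan (P.maxTurningAngle / 2))

/-- The index distance between `v_i` and `v_j`: the number of edges on a shortest path from one
to the other along the polygon, that is, `|i - j|` or `n - |i - j|`, whichever is smaller. -/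
def indexDist (i j : ZMod n) : ℕ := (i - j).valMinAbs.natAbs

/-- The sphere radius: half the minimal distance between vertices whose index distance is at
least `⌈π MinRad(P) / dl - 1⌉`. -/
def sphereRadius : ℝ :=
  sInf {d : ℝ | ∃ i j : ZMod n,
    ⌈Real.pi * P.minRad / P.dl - 1⌉ ≤ (indexDist i j : ℤ) ∧
      d = dist (P.vertex i) (P.vertex j)} / 2

/-- The sphere thickness radius `R_s(P)`. -/
def sphereThickness : ℝ :=
  min (Real.sqrt (P.minRad ^ 2 + (P.dl / 2) ^ 2)) P.sphereRadius

/-- `R_c(P)`, the radius of the circles in which consecutive spheres of radius `R_s(P)` meet. -/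
def circleRadius : ℝ := Real.sqrt (P.sphereThickness ^ 2 - P.dl ^ 2 / 4)

/-! ### The inscribed smooth curve -/

/-- The unit vector in the direction of the edge from `v_i` to `v_{i+1}`. -/
def edgeDir (i : ZMod n) : E3 := P.dl⁻¹ • P.edge i

/-- The unit vector in the plane of the corner at `v_i` that is normal to the incoming edge and
points to the side of the outgoing edge (for a turning angle strictly between `0` and `π`). -/
def cornerNormal (i : ZMod n) : E3 :=
  (Real.sin (P.turningAngle i))⁻¹ •
    (P.edgeDir i - Real.cos (P.turningAngle i) • P.edgeDir (i - 1))

/-- The length of the arc inscribed at `v_i`. -/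
def arcLength (i : ZMod n) : ℝ :=
  if P.turningAngle i = 0 then P.dl else P.rad i * P.turningAngle i

/-- The arc inscribed at `v_i`, parametrized by arclength `t ∈ [0, arcLength i]`. It starts at the
midpoint of the incoming edge, tangent to that edge, and runs along the circle of radius `rad i`
in the plane of the corner until it is tangent to the outgoing edge at its midpoint. At a
straight vertex it is the segment between the two midpoints. -/
def arc (i : ZMod n) (t : ℝ) : E3 :=
  midpoint ℝ (P.vertex (i - 1)) (P.vertex i) +
    if P.turningAngle i = 0 then t • P.edgeDir (i - 1)
    else P.rad i • (Real.sin (t / P.rad i) • P.edgeDir (i - 1) +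
      (1 - Real.cos (t / P.rad i)) • P.cornerNormal i)

/-- The arclength at which the arc number `k` begins, when the arcs at
`v_0, v_1, v_2, …` are traversed one after the other. -/
def arcStart (k : ℕ) : ℝ := ∑ j ∈ Finset.range k, P.arcLength (j : ZMod n)

/-- The total length of the inscribed arcs, which is the period of the inscribed curve. -/
def period : ℝ := P.arcStart n

open Classical in
/-- The inscribed curve `K_P`: the concatenation of the inscribed arcs, parametrized by arclength
and extended periodically. The parameter `s` is first reduced to `u ∈ [0, period)`, and `k` is
the number of the arc with `arcStart k ≤ u < arcStart (k + 1)`. -/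
def inscribed (s : ℝ) : E3 :=
  let u := P.period * Int.fract (s / P.period)
  let k := Nat.findGreatest (fun k => P.arcStart k ≤ u) (n - 1)
  P.arc (k : ZMod n) (u - P.arcStart k)

end EquilateralKnot

end Ropelength

end

namespace Ropelength

/-! ### Ambient isotopies -/

/-! The bound `R_s > dl/√2` gives `MinRad > dl/2`, so every turning angle is below `π/2`, and also
`R_c ≤ MinRad`. The inscribed curve has unit speed and a continuous tangent, and along arclength `ℓ`
its tangent turns by at most `ℓ / MinRad` (`angle_deriv_inscribed_le`).

Thickness: let `r < R_c` and take two points of the curve, on the arcs at `v_i` and `v_j`. If the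
index distance is large, then `v_i` and `v_j` are at least `2 R_s` apart, while each normal disk
lies in the ball of radius `√(r² + dl²/4) < R_s` about its vertex (`norm_arc_add_sub_vertex_sq_le`).
If it is small, the points are within arclength `π MinRad` of each other, because no arc is longer
than `dl`; a comparison with the circle of radius `MinRad`, in the style of Schur's theorem, then
separates the disks (`disjoint_normalDisk_of_angle_le`). Radius `0` gives simplicity.

Isotopy: in coordinates along the two edge directions at a corner, an arc point slides to the
polygon point with the same coordinate sum. The velocity of this straight-line homotopy is, at all
times, a Lipschitz function of position. In one corner this holds because the coordinate sum is
conserved; for adjacent corners, because they lie in opposite cones at the common midpoint; for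
other pairs, because the vertices are more than `dl` apart (`dl_lt_dist_vertex`) while each corner
stays within `dl/2` of its vertex. `AmbientIsotopic.of_linear_homotopy` turns such a homotopy into
an ambient isotopy. The ropelength bounds follow by dividing the length by the thickness. -/

theorem AmbientIsotopic.refl (A : Set E3) : AmbientIsotopic A A :=
  ⟨fun _ => Homeomorph.refl E3, continuous_snd, rfl, by simp⟩

theorem AmbientIsotopic.trans {A B C : Set E3} (h₁ : AmbientIsotopic A B)
    (h₂ : AmbientIsotopic B C) : AmbientIsotopic A C := by
  obtain ⟨F, hF, hF0, hF1⟩ := h₁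
  obtain ⟨G, hG, hG0, hG1⟩ := h₂
  refine ⟨fun t => (F t).trans (G t), ?_, ?_, ?_⟩
  · exact hG.comp (continuous_fst.prodMk hF)
  · ext1 x
    simp [hF0, hG0]
  · rw [← hG1, ← hF1, Set.image_image]
    rfl

/-- A perturbation of the identity by a contraction is bijective with Lipschitz inverse, which is
the global form of the inverse function theorem. -/
theorem exists_homeomorph_id_add {c : NNReal} {g : E3 → E3} (hg : LipschitzWith c g)
    (hc : c < 1) : ∃ h : E3 ≃ₜ E3, ∀ x, h x = x + g x := by
  have happ : ApproximatesLinearOn (fun x => x + g x)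
      (ContinuousLinearEquiv.refl ℝ E3 : E3 →L[ℝ] E3) Set.univ c := by
    intro x _ y _
    have h : x + g x - (y + g y) - (ContinuousLinearEquiv.refl ℝ E3 : E3 →L[ℝ] E3) (x - y) =
        g x - g y := by
      simp only [ContinuousLinearEquiv.coe_coe, ContinuousLinearEquiv.refl_apply]
      abel
    rw [h]
    exact hg.norm_sub_le x y
  refine ⟨happ.toHomeomorph _ (Or.inr ?_), fun x => rfl⟩
  have h1 : ‖((ContinuousLinearEquiv.refl ℝ E3).symm : E3 →L[ℝ] E3)‖₊ = 1 := by
    rw [← NNReal.coe_inj]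
    exact ContinuousLinearMap.norm_id
  rwa [h1, inv_one]

/-- A short displacement of a set by a Lipschitz vector field is an ambient isotopy. -/
theorem AmbientIsotopic.of_small_displacement {ι : Type*} {X q : ι → E3} {K : NNReal}
    (hK : ∀ s t, ‖q s - q t‖ ≤ K * ‖X s - X t‖) {ε : NNReal}
    (hε : ε * (lipschitzExtensionConstant E3 * K) < 1) :
    AmbientIsotopic (Set.range X) (Set.range fun s => X s + (ε : ℝ) • q s) := by
  -- The Lipschitz bound makes `q` a function of the position `X`, so it can be extended from the
  -- set to a Lipschitz field on all of space.
  have hfac : Function.FactorsThrough q X := by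
    intro s t hst
    have h := hK s t
    rw [hst, sub_self, norm_zero, mul_zero] at h
    exact sub_eq_zero.1 (norm_le_zero_iff.1 h)
  have hlip : LipschitzOnWith K (Function.extend X q 0) (Set.range X) := by
    refine LipschitzOnWith.of_dist_le_mul ?_
    rintro _ ⟨s, rfl⟩ _ ⟨t, rfl⟩
    rw [hfac.extend_apply, hfac.extend_apply, dist_eq_norm, dist_eq_norm]
    exact hK s t
  obtain ⟨g, hg, hgX⟩ := hlip.extend_finite_dimension
  have hgX' : ∀ s, g (X s) = q s := fun s => by
    rw [← hgX (Set.mem_range_self s), hfac.extend_apply]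
  have hH : ∀ τ : unitInterval, ∃ h : E3 ≃ₜ E3, ∀ x, h x = x + ((τ : ℝ) * ε) • g x := by
    intro τ
    refine exists_homeomorph_id_add (c := ε * (lipschitzExtensionConstant E3 * K))
      (LipschitzWith.of_dist_le_mul fun x y => ?_) hε
    have h0 : ‖(τ : ℝ) * ε‖ = τ * ε := Real.norm_of_nonneg (mul_nonneg τ.2.1 ε.2)
    rw [dist_smul₀, h0]
    have h1 : dist (g x) (g y) ≤ (lipschitzExtensionConstant E3 * K : NNReal) * dist x y :=
      hg.dist_le_mul x y
    have h2 : (τ : ℝ) * ε ≤ ε := mul_le_of_le_one_left ε.2 τ.2.2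
    calc (τ : ℝ) * ε * dist (g x) (g y)
        ≤ ε * ((lipschitzExtensionConstant E3 * K : NNReal) * dist x y) :=
          mul_le_mul h2 h1 dist_nonneg ε.2
      _ = _ := by push_cast; ring
  choose H hH using hH
  refine ⟨H, ?_, ?_, ?_⟩
  · simp only [hH]
    have := hg.continuous
    fun_prop
  · ext1 x
    simp [hH]
  · rw [← Set.range_comp]
    congr 1
    ext1 s
    simp [hH, hgX']

/-- A straight-line homotopy that is uniformly bi-Lipschitz, in the sense that its velocity is
a Lipschitz function of the position at all times, is induced by an ambient isotopy. -/
theorem AmbientIsotopic.of_linear_homotopy {ι : Type*} {X q : ι → E3} {K : NNReal}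
    (hK : ∀ τ ∈ Set.Icc (0 : ℝ) 1, ∀ s t, ‖q s - q t‖ ≤ K * ‖(X s + τ • q s) - (X t + τ • q t)‖) :
    AmbientIsotopic (Set.range X) (Set.range fun s => X s + q s) := by
  -- The bound `K` is the same at all times, so one step size `1 / N` is short enough at each of the
  -- `N` intermediate positions.
  obtain ⟨N, hN⟩ := exists_nat_gt (lipschitzExtensionConstant E3 * K)
  have hN0 : (0 : NNReal) < N := lt_of_le_of_lt zero_le hN
  have key : ∀ k : ℕ, k ≤ N → AmbientIsotopic (Set.range X)
      (Set.range fun s => X s + ((k : ℝ) / N) • q s) := by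
    intro k
    induction k with
    | zero => intro _; simpa using AmbientIsotopic.refl _
    | succ k ih =>
      intro hk
      refine (ih (by omega)).trans ?_
      have hk1 : ((k : ℝ) / N) ∈ Set.Icc (0 : ℝ) 1 :=
        ⟨by positivity, div_le_one_of_le₀ (by exact_mod_cast (by omega : k ≤ N)) (by positivity)⟩
      have h := AmbientIsotopic.of_small_displacement (ε := (N : NNReal)⁻¹) (hK _ hk1) (by
        rw [inv_mul_eq_div]
        exact (div_lt_one hN0).2 hN)
      convert h using 3 with s
      rw [add_assoc, ← add_smul]
      congr 2
      push_cast
      field_simp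
  have h := key N le_rfl
  have hN1 : (N : ℝ) ≠ 0 := by exact_mod_cast hN0.ne'
  simpa [div_self hN1] using h

namespace EquilateralKnot

variable {n : ℕ} [NeZero n] (P : EquilateralKnot n)

/-! ### Edges and turning angles -/

theorem norm_edge (i : ZMod n) : ‖P.edge i‖ = P.dl := by
  rw [edge, ← dist_eq_norm, dist_comm, P.dist_vertex]

theorem norm_edgeDir (i : ZMod n) : ‖P.edgeDir i‖ = 1 := by
  rw [edgeDir, norm_smul, norm_edge, Real.norm_of_nonneg (inv_nonneg.2 P.dl_pos.le),
    inv_mul_cancel₀ P.dl_pos.ne']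

theorem inner_edgeDir_self (i : ZMod n) : ⟪P.edgeDir i, P.edgeDir i⟫ = 1 := by
  rw [real_inner_self_eq_norm_sq, norm_edgeDir, one_pow]

theorem dl_smul_edgeDir (i : ZMod n) : P.dl • P.edgeDir i = P.edge i := by
  rw [edgeDir, smul_smul, mul_inv_cancel₀ P.dl_pos.ne', one_smul]

theorem vertex_succ (i : ZMod n) : P.vertex (i + 1) = P.vertex i + P.dl • P.edgeDir i := by
  rw [dl_smul_edgeDir, edge]
  abel

theorem angle_edgeDir (i : ZMod n) :
    InnerProductGeometry.angle (P.edgeDir (i - 1)) (P.edgeDir i) = P.turningAngle i := by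
  have h := inv_pos.2 P.dl_pos
  rw [edgeDir, edgeDir, InnerProductGeometry.angle_smul_left_of_pos _ _ h,
    InnerProductGeometry.angle_smul_right_of_pos _ _ h, turningAngle]

theorem inner_edgeDir (i : ZMod n) :
    ⟪P.edgeDir (i - 1), P.edgeDir i⟫ = Real.cos (P.turningAngle i) := by
  rw [← angle_edgeDir, InnerProductGeometry.cos_angle, norm_edgeDir, norm_edgeDir]
  simp

theorem turningAngle_nonneg (i : ZMod n) : 0 ≤ P.turningAngle i :=
  InnerProductGeometry.angle_nonneg _ _

theorem turningAngle_le_max (i : ZMod n) : P.turningAngle i ≤ P.maxTurningAngle :=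
  le_ciSup (Set.finite_range P.turningAngle).bddAbove i

theorem maxTurningAngle_nonneg : 0 ≤ P.maxTurningAngle :=
  (P.turningAngle_nonneg 0).trans (P.turningAngle_le_max 0)

theorem maxTurningAngle_le_pi : P.maxTurningAngle ≤ Real.pi :=
  ciSup_le fun _ => InnerProductGeometry.angle_le_pi _ _

/-! ### Consequences of the lower bound on the sphere thickness radius -/

theorem minRad_nonneg : 0 ≤ P.minRad :=
  div_nonneg P.dl_pos.le (mul_nonneg zero_le_two (Real.tan_nonneg_of_nonneg_of_le_pi_div_two
    (by linarith [P.maxTurningAngle_nonneg]) (by linarith [P.maxTurningAngle_le_pi])))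

variable {P}

theorem sq_dl_lt (hP : P.dl / Real.sqrt 2 < P.sphereThickness) :
    P.dl ^ 2 / 2 < P.sphereThickness ^ 2 := by
  have h := pow_lt_pow_left₀ hP (div_nonneg P.dl_pos.le (Real.sqrt_nonneg 2)) two_ne_zero
  rwa [div_pow, Real.sq_sqrt zero_le_two] at h

theorem sphereThickness_pos (hP : P.dl / Real.sqrt 2 < P.sphereThickness) :
    0 < P.sphereThickness :=
  (div_nonneg P.dl_pos.le (Real.sqrt_nonneg 2)).trans_lt hP

theorem sphereThickness_sq_le (hP : P.dl / Real.sqrt 2 < P.sphereThickness) :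
    P.sphereThickness ^ 2 ≤ P.minRad ^ 2 + (P.dl / 2) ^ 2 := by
  rw [← Real.sq_sqrt (by positivity : 0 ≤ P.minRad ^ 2 + (P.dl / 2) ^ 2)]
  exact pow_le_pow_left₀ (sphereThickness_pos hP).le (min_le_left _ _) 2

theorem half_dl_lt_minRad (hP : P.dl / Real.sqrt 2 < P.sphereThickness) :
    P.dl / 2 < P.minRad := by
  refine lt_of_pow_lt_pow_left₀ 2 P.minRad_nonneg ?_
  have h1 := sq_dl_lt hP
  have h2 := sphereThickness_sq_le hP
  nlinarith

theorem minRad_pos (hP : P.dl / Real.sqrt 2 < P.sphereThickness) : 0 < P.minRad :=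
  (half_pos P.dl_pos).trans (half_dl_lt_minRad hP)

theorem circleRadius_sq (hP : P.dl / Real.sqrt 2 < P.sphereThickness) :
    P.circleRadius ^ 2 = P.sphereThickness ^ 2 - P.dl ^ 2 / 4 := by
  have h1 := sq_dl_lt hP
  exact Real.sq_sqrt (by nlinarith [sq_nonneg P.dl])

theorem circleRadius_pos (hP : P.dl / Real.sqrt 2 < P.sphereThickness) : 0 < P.circleRadius := by
  have h1 := sq_dl_lt hP
  exact Real.sqrt_pos.2 (by nlinarith [sq_nonneg P.dl])

theorem circleRadius_le_minRad (hP : P.dl / Real.sqrt 2 < P.sphereThickness) :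
    P.circleRadius ≤ P.minRad := by
  refine le_of_sq_le_sq ?_ P.minRad_nonneg
  rw [circleRadius_sq hP]
  linarith [sphereThickness_sq_le hP]

theorem tan_half_maxTurningAngle (hP : P.dl / Real.sqrt 2 < P.sphereThickness) :
    0 < Real.tan (P.maxTurningAngle / 2) ∧ Real.tan (P.maxTurningAngle / 2) < 1 := by
  have h1 := half_dl_lt_minRad hP
  have h0 := P.dl_pos
  have hT : 0 ≤ Real.tan (P.maxTurningAngle / 2) :=
    Real.tan_nonneg_of_nonneg_of_le_pi_div_two
      (by linarith [P.maxTurningAngle_nonneg]) (by linarith [P.maxTurningAngle_le_pi])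
  have hT' : 0 < Real.tan (P.maxTurningAngle / 2) := by
    -- Division by zero gives `minRad = 0` when this tangent vanishes, contrary to `minRad > dl /
    -- 2`.
    refine hT.lt_of_ne fun h => ?_
    rw [minRad, ← h] at h1
    simp only [mul_zero, div_zero] at h1
    linarith
  refine ⟨hT', ?_⟩
  rw [minRad, lt_div_iff₀ (by positivity)] at h1
  nlinarith

theorem maxTurningAngle_lt (hP : P.dl / Real.sqrt 2 < P.sphereThickness) :
    P.maxTurningAngle < Real.pi / 2 := by
  obtain ⟨h1, h2⟩ := tan_half_maxTurningAngle hP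
  by_contra! h
  have hlt : P.maxTurningAngle / 2 < Real.pi / 2 := by
    -- A maximal angle `π` is excluded by the convention `tan (π / 2) = 0`.
    refine lt_of_le_of_ne (by linarith [P.maxTurningAngle_le_pi]) fun h' => ?_
    rw [h', Real.tan_pi_div_two] at h1
    exact h1.false
  have h3 : Real.tan (Real.pi / 4) ≤ Real.tan (P.maxTurningAngle / 2) :=
    Real.strictMonoOn_tan.monotoneOn ⟨by linarith [Real.pi_pos], by linarith [Real.pi_pos]⟩
      ⟨by linarith [Real.pi_pos], hlt⟩ (by linarith)
  rw [Real.tan_pi_div_four] at h3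
  linarith

theorem turningAngle_lt (hP : P.dl / Real.sqrt 2 < P.sphereThickness) (i : ZMod n) :
    P.turningAngle i < Real.pi / 2 :=
  (P.turningAngle_le_max i).trans_lt (maxTurningAngle_lt hP)

theorem cos_turningAngle_pos (hP : P.dl / Real.sqrt 2 < P.sphereThickness) (i : ZMod n) :
    0 < Real.cos (P.turningAngle i) :=
  Real.cos_pos_of_mem_Ioo ⟨by linarith [P.turningAngle_nonneg i, Real.pi_pos],
    turningAngle_lt hP i⟩

theorem sin_turningAngle_pos (hP : P.dl / Real.sqrt 2 < P.sphereThickness) {i : ZMod n}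
    (hi : P.turningAngle i ≠ 0) : 0 < Real.sin (P.turningAngle i) :=
  Real.sin_pos_of_pos_of_lt_pi ((P.turningAngle_nonneg i).lt_of_ne' hi)
    ((turningAngle_lt hP i).trans (by linarith [Real.pi_pos]))

theorem tan_half_turningAngle_le (hP : P.dl / Real.sqrt 2 < P.sphereThickness) (i : ZMod n) :
    Real.tan (P.turningAngle i / 2) ≤ Real.tan (P.maxTurningAngle / 2) :=
  Real.strictMonoOn_tan.monotoneOn
    ⟨by linarith [P.turningAngle_nonneg i, Real.pi_pos],
      by linarith [turningAngle_lt hP i, Real.pi_pos]⟩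
    ⟨by linarith [P.maxTurningAngle_nonneg, Real.pi_pos],
      by linarith [maxTurningAngle_lt hP, Real.pi_pos]⟩
    (by linarith [P.turningAngle_le_max i])

theorem tan_half_turningAngle_pos (hP : P.dl / Real.sqrt 2 < P.sphereThickness) {i : ZMod n}
    (hi : P.turningAngle i ≠ 0) : 0 < Real.tan (P.turningAngle i / 2) :=
  Real.tan_pos_of_pos_of_lt_pi_div_two
    (half_pos ((P.turningAngle_nonneg i).lt_of_ne' hi))
    (by linarith [turningAngle_lt hP i, Real.pi_pos])

theorem rad_pos (hP : P.dl / Real.sqrt 2 < P.sphereThickness) {i : ZMod n}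
    (hi : P.turningAngle i ≠ 0) : 0 < P.rad i :=
  div_pos P.dl_pos (mul_pos two_pos (tan_half_turningAngle_pos hP hi))

theorem minRad_le_rad (hP : P.dl / Real.sqrt 2 < P.sphereThickness) {i : ZMod n}
    (hi : P.turningAngle i ≠ 0) : P.minRad ≤ P.rad i :=
  div_le_div_of_nonneg_left P.dl_pos.le (mul_pos two_pos (tan_half_turningAngle_pos hP hi))
    (mul_le_mul_of_nonneg_left (tan_half_turningAngle_le hP i) zero_le_two)

/-- The default value is convenient: `0⁻¹ = 0` is the true curvature at a straight vertex, so
formulas in `(P.rad i)⁻¹` and `t / P.rad i` need no separate case. -/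
theorem rad_of_turningAngle_eq_zero {i : ZMod n} (hi : P.turningAngle i = 0) : P.rad i = 0 := by
  simp [rad, hi]

theorem inv_rad_nonneg (hP : P.dl / Real.sqrt 2 < P.sphereThickness) (i : ZMod n) :
    0 ≤ (P.rad i)⁻¹ := by
  by_cases hi : P.turningAngle i = 0
  · simp [rad_of_turningAngle_eq_zero hi]
  · exact inv_nonneg.2 (rad_pos hP hi).le

theorem inv_rad_le (hP : P.dl / Real.sqrt 2 < P.sphereThickness) (i : ZMod n) :
    (P.rad i)⁻¹ ≤ P.minRad⁻¹ := by
  by_cases hi : P.turningAngle i = 0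
  · simp [rad_of_turningAngle_eq_zero hi, P.minRad_nonneg]
  · exact inv_anti₀ (minRad_pos hP) (minRad_le_rad hP hi)

/-- These half-angle identities are what makes the arc end at the midpoint of the outgoing edge. -/
theorem rad_mul_sin_cos (hP : P.dl / Real.sqrt 2 < P.sphereThickness) {i : ZMod n}
    (hi : P.turningAngle i ≠ 0) :
    P.rad i * Real.sin (P.turningAngle i) = P.dl / 2 * (1 + Real.cos (P.turningAngle i)) ∧
    P.rad i * (1 - Real.cos (P.turningAngle i)) = P.dl / 2 * Real.sin (P.turningAngle i) := by
  have h0 := (P.turningAngle_nonneg i).lt_of_ne' hi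
  have h1 := turningAngle_lt hP i
  have hs : Real.sin (P.turningAngle i / 2) ≠ 0 :=
    (Real.sin_pos_of_pos_of_lt_pi (by linarith) (by linarith)).ne'
  have hc : Real.cos (P.turningAngle i / 2) ≠ 0 :=
    (Real.cos_pos_of_mem_Ioo ⟨by linarith, by linarith⟩).ne'
  have e1 : Real.sin (P.turningAngle i) =
      2 * Real.sin (P.turningAngle i / 2) * Real.cos (P.turningAngle i / 2) := by
    rw [← Real.sin_two_mul]
    ring_nf
  have e2 : Real.cos (P.turningAngle i) = 2 * Real.cos (P.turningAngle i / 2) ^ 2 - 1 := by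
    rw [← Real.cos_two_mul]
    ring_nf
  have e3 := Real.sin_sq_add_cos_sq (P.turningAngle i / 2)
  rw [rad, Real.tan_eq_sin_div_cos, e1, e2]
  constructor
  · field_simp
    ring
  · field_simp
    linear_combination (-2 * P.dl) * e3

/-! ### The inscribed arcs -/

theorem arcLength_of_ne {i : ZMod n} (hi : P.turningAngle i ≠ 0) :
    P.arcLength i = P.rad i * P.turningAngle i := if_neg hi

theorem arcLength_of_eq {i : ZMod n} (hi : P.turningAngle i = 0) :
    P.arcLength i = P.dl := if_pos hi

theorem arcLength_pos (hP : P.dl / Real.sqrt 2 < P.sphereThickness) (i : ZMod n) :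
    0 < P.arcLength i := by
  by_cases hi : P.turningAngle i = 0
  · rw [arcLength_of_eq hi]
    exact P.dl_pos
  · rw [arcLength_of_ne hi]
    exact mul_pos (rad_pos hP hi) ((P.turningAngle_nonneg i).lt_of_ne' hi)

/-- Since `x < tan x`, an arc is shorter than its two tangent segments, which are half edges. -/
theorem arcLength_le (hP : P.dl / Real.sqrt 2 < P.sphereThickness) (i : ZMod n) :
    P.arcLength i ≤ P.dl := by
  by_cases hi : P.turningAngle i = 0
  · rw [arcLength_of_eq hi]
  · have h0 := (P.turningAngle_nonneg i).lt_of_ne' hi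
    have h := Real.lt_tan (half_pos h0)
      (by linarith [turningAngle_lt hP i, Real.pi_pos])
    have hT := tan_half_turningAngle_pos hP hi
    rw [arcLength_of_ne hi, rad, div_mul_eq_mul_div, div_le_iff₀ (by positivity)]
    nlinarith [P.dl_pos]

theorem edgeDir_eq (hP : P.dl / Real.sqrt 2 < P.sphereThickness) {i : ZMod n}
    (hi : P.turningAngle i ≠ 0) :
    P.edgeDir i = Real.cos (P.turningAngle i) • P.edgeDir (i - 1) +
      Real.sin (P.turningAngle i) • P.cornerNormal i := by
  rw [cornerNormal, smul_smul, mul_inv_cancel₀ (sin_turningAngle_pos hP hi).ne', one_smul]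
  abel

theorem edgeDir_eq_of_eq {i : ZMod n} (hi : P.turningAngle i = 0) :
    P.edgeDir i = P.edgeDir (i - 1) := by
  have h := P.inner_edgeDir i
  rw [hi, Real.cos_zero] at h
  exact ((inner_eq_one_iff_of_norm_eq_one (P.norm_edgeDir _) (P.norm_edgeDir _)).1 h).symm

theorem inner_edgeDir_cornerNormal (i : ZMod n) :
    ⟪P.edgeDir (i - 1), P.cornerNormal i⟫ = 0 := by
  rw [cornerNormal, inner_smul_right, inner_sub_right, inner_smul_right, inner_edgeDir,
    inner_edgeDir_self]
  ring

theorem inner_cornerNormal_self (hP : P.dl / Real.sqrt 2 < P.sphereThickness) {i : ZMod n}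
    (hi : P.turningAngle i ≠ 0) : ⟪P.cornerNormal i, P.cornerNormal i⟫ = 1 := by
  have hs := (sin_turningAngle_pos hP hi).ne'
  have h := P.inner_edgeDir_self i
  have h' := P.inner_edgeDir_cornerNormal i
  have h2 : ⟪P.cornerNormal i, P.edgeDir (i - 1)⟫ = 0 := by rw [real_inner_comm, h']
  rw [edgeDir_eq hP hi] at h
  simp only [inner_add_left, inner_add_right, inner_smul_left, inner_smul_right,
    inner_edgeDir_self, h', h2, conj_trivial] at h
  have h3 := Real.sin_sq_add_cos_sq (P.turningAngle i)
  have : Real.sin (P.turningAngle i) ^ 2 * (⟪P.cornerNormal i, P.cornerNormal i⟫ - 1) = 0 := by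
    linear_combination h - h3
  rcases mul_eq_zero.1 this with h4 | h4
  · exact absurd h4 (pow_ne_zero 2 hs)
  · linarith

variable (P) in
/-- The unit tangent vector of the arc inscribed at `v_i`. -/
noncomputable def arcTangent (i : ZMod n) (t : ℝ) : E3 :=
  Real.cos (t / P.rad i) • P.edgeDir (i - 1) + Real.sin (t / P.rad i) • P.cornerNormal i

theorem inner_arcTangent (hP : P.dl / Real.sqrt 2 < P.sphereThickness) (i : ZMod n) (s t : ℝ) :
    ⟪P.arcTangent i s, P.arcTangent i t⟫ = Real.cos ((s - t) * (P.rad i)⁻¹) := by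
  by_cases hi : P.turningAngle i = 0
  · simp [arcTangent, rad_of_turningAngle_eq_zero hi, norm_edgeDir]
  · have h' := P.inner_edgeDir_cornerNormal i
    have h2 : ⟪P.cornerNormal i, P.edgeDir (i - 1)⟫ = 0 := by rw [real_inner_comm, h']
    simp only [arcTangent, inner_add_left, inner_add_right, inner_smul_left, inner_smul_right,
      inner_edgeDir_self, h', h2, inner_cornerNormal_self hP hi, conj_trivial]
    rw [sub_mul, Real.cos_sub, ← div_eq_mul_inv, ← div_eq_mul_inv]
    ring

theorem norm_arcTangent (hP : P.dl / Real.sqrt 2 < P.sphereThickness) (i : ZMod n) (t : ℝ) :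
    ‖P.arcTangent i t‖ = 1 := by
  have h := inner_arcTangent hP i t t
  rw [real_inner_self_eq_norm_sq, sub_self, zero_mul, Real.cos_zero] at h
  exact (pow_eq_one_iff_of_nonneg (norm_nonneg _) two_ne_zero).1 h

theorem arccos_cos_le_abs (x : ℝ) : Real.arccos (Real.cos x) ≤ |x| := by
  rcases le_total |x| Real.pi with h | h
  · rw [← Real.cos_abs, Real.arccos_cos (abs_nonneg x) h]
  · exact (Real.arccos_le_pi _).trans h

theorem angle_arcTangent_le (hP : P.dl / Real.sqrt 2 < P.sphereThickness) (i : ZMod n)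
    (s t : ℝ) : InnerProductGeometry.angle (P.arcTangent i s) (P.arcTangent i t) ≤
      |s - t| / P.minRad := by
  rw [InnerProductGeometry.angle, norm_arcTangent hP, norm_arcTangent hP, inner_arcTangent hP,
    mul_one, div_one]
  refine (arccos_cos_le_abs _).trans ?_
  rw [abs_mul, abs_of_nonneg (inv_rad_nonneg hP i), div_eq_mul_inv]
  exact mul_le_mul_of_nonneg_left (inv_rad_le hP i) (abs_nonneg _)

theorem hasDerivAt_arc (hP : P.dl / Real.sqrt 2 < P.sphereThickness) (i : ZMod n) (t : ℝ) :
    HasDerivAt (P.arc i) (P.arcTangent i t) t := by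
  unfold arc arcTangent
  by_cases hi : P.turningAngle i = 0
  · simp only [hi, if_true, rad_of_turningAngle_eq_zero hi, div_zero, Real.cos_zero, one_smul,
      Real.sin_zero, zero_smul, add_zero]
    simpa using ((hasDerivAt_id t).smul_const (P.edgeDir (i - 1))).const_add
      (midpoint ℝ (P.vertex (i - 1)) (P.vertex i))
  · simp only [hi, if_false]
    have hr := (rad_pos hP hi).ne'
    have hd : HasDerivAt (fun t : ℝ => t / P.rad i) (P.rad i)⁻¹ t := by
      simpa using (hasDerivAt_id t).div_const (P.rad i)
    have h1 := (hd.sin.smul_const (P.edgeDir (i - 1))).add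
      ((hd.cos.const_sub 1).smul_const (P.cornerNormal i))
    have h2 := (h1.const_smul (P.rad i)).const_add (midpoint ℝ (P.vertex (i - 1)) (P.vertex i))
    refine h2.congr_deriv ?_
    rw [smul_add, smul_smul, smul_smul]
    congr 2 <;> field_simp

theorem arcTangent_zero (i : ZMod n) : P.arcTangent i 0 = P.edgeDir (i - 1) := by
  simp [arcTangent]

theorem arcTangent_arcLength (hP : P.dl / Real.sqrt 2 < P.sphereThickness) (i : ZMod n) :
    P.arcTangent i (P.arcLength i) = P.edgeDir i := by
  by_cases hi : P.turningAngle i = 0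
  · simp [arcTangent, rad_of_turningAngle_eq_zero hi, edgeDir_eq_of_eq hi]
  · rw [arcTangent, arcLength_of_ne hi, mul_div_cancel_left₀ _ (rad_pos hP hi).ne',
      ← edgeDir_eq hP hi]

theorem midpoint_eq (i : ZMod n) :
    midpoint ℝ (P.vertex (i - 1)) (P.vertex i) =
      P.vertex i - (P.dl / 2) • P.edgeDir (i - 1) := by
  have h : P.vertex i = P.vertex (i - 1) + P.dl • P.edgeDir (i - 1) := by
    rw [← vertex_succ, sub_add_cancel]
  rw [midpoint_eq_smul_add, invOf_eq_inv, h]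
  module

theorem midpoint_succ_eq (i : ZMod n) :
    midpoint ℝ (P.vertex i) (P.vertex (i + 1)) =
      P.vertex i + (P.dl / 2) • P.edgeDir i := by
  rw [midpoint_eq_smul_add, invOf_eq_inv, vertex_succ]
  module

theorem arc_zero (i : ZMod n) :
    P.arc i 0 = midpoint ℝ (P.vertex (i - 1)) (P.vertex i) := by
  simp [arc]

theorem arc_arcLength (hP : P.dl / Real.sqrt 2 < P.sphereThickness) (i : ZMod n) :
    P.arc i (P.arcLength i) = midpoint ℝ (P.vertex i) (P.vertex (i + 1)) := by
  rw [midpoint_succ_eq, arc, midpoint_eq]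
  by_cases hi : P.turningAngle i = 0
  · rw [if_pos hi, arcLength_of_eq hi, edgeDir_eq_of_eq hi]
    module
  · rw [if_neg hi, arcLength_of_ne hi, mul_div_cancel_left₀ _ (rad_pos hP hi).ne', smul_add,
      smul_smul, smul_smul, (rad_mul_sin_cos hP hi).1, (rad_mul_sin_cos hP hi).2,
      edgeDir_eq hP hi]
    module

/-! ### The inscribed curve -/

theorem arcStart_zero : P.arcStart 0 = 0 := by simp [arcStart]

theorem arcStart_succ (k : ℕ) : P.arcStart (k + 1) = P.arcStart k + P.arcLength (k : ZMod n) :=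
  Finset.sum_range_succ _ _

theorem arcStart_add_period (k : ℕ) : P.arcStart (k + n) = P.arcStart k + P.period := by
  induction k with
  | zero => rw [zero_add, arcStart_zero, zero_add, period]
  | succ k ih =>
    rw [add_right_comm, arcStart_succ, ih, arcStart_succ, Nat.cast_add, ZMod.natCast_self,
      add_zero]
    ring

theorem arcStart_strictMono (hP : P.dl / Real.sqrt 2 < P.sphereThickness) :
    StrictMono P.arcStart :=
  strictMono_nat_of_lt_succ fun k => by
    rw [arcStart_succ]
    linarith [arcLength_pos hP (k : ZMod n)]

theorem period_pos (hP : P.dl / Real.sqrt 2 < P.sphereThickness) : 0 < P.period := by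
  rw [← P.arcStart_zero]
  exact arcStart_strictMono hP (NeZero.pos n)

theorem arcStart_le (hP : P.dl / Real.sqrt 2 < P.sphereThickness) (j d : ℕ) :
    P.arcStart (j + d) ≤ P.arcStart j + d * P.dl := by
  induction d with
  | zero => simp
  | succ d ih =>
    rw [← add_assoc, arcStart_succ]
    have h := arcLength_le hP ((j + d : ℕ) : ZMod n)
    push_cast at h ⊢
    linarith

theorem arcStart_mul (m : ℕ) : P.arcStart (m * n) = m * P.period := by
  induction m with
  | zero => simp [arcStart_zero]
  | succ m ih =>
    rw [add_mul, one_mul, arcStart_add_period, ih]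
    push_cast
    ring

theorem exists_mem_piece (hP : P.dl / Real.sqrt 2 < P.sphereThickness) {s : ℝ} (hs : 0 ≤ s) :
    ∃ k : ℕ, P.arcStart k ≤ s ∧ s < P.arcStart (k + 1) := by
  classical
  have hex : ∃ k, s < P.arcStart k := by
    obtain ⟨m, hm⟩ := exists_nat_gt (s / P.period)
    refine ⟨m * n, ?_⟩
    rwa [arcStart_mul, ← div_lt_iff₀ (period_pos hP)]
  have h0 : Nat.find hex ≠ 0 := fun h => by
    have h1 := Nat.find_spec hex
    rw [h, arcStart_zero] at h1
    linarith
  obtain ⟨k, hk⟩ := Nat.exists_eq_succ_of_ne_zero h0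
  refine ⟨k, not_lt.1 (Nat.find_min hex (by omega)), ?_⟩
  have h1 := Nat.find_spec hex
  rwa [hk] at h1

theorem inscribed_periodic (hP : P.dl / Real.sqrt 2 < P.sphereThickness) :
    Function.Periodic P.inscribed P.period := by
  intro s
  have h : Int.fract ((s + P.period) / P.period) = Int.fract (s / P.period) := by
    rw [add_div, div_self (period_pos hP).ne', Int.fract_add_one]
  simp only [inscribed, h]

theorem inscribed_eq_of_lt (hP : P.dl / Real.sqrt 2 < P.sphereThickness) {k : ℕ} {s : ℝ}
    (h1 : P.arcStart k ≤ s) (h2 : s < P.arcStart (k + 1)) :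
    P.inscribed s = P.arc (k : ZMod n) (s - P.arcStart k) := by
  classical
  induction k using Nat.strong_induction_on generalizing s with
  | _ k ih =>
    rcases lt_or_ge k n with hk | hk
    · have hmono := arcStart_strictMono hP
      have hL := period_pos hP
      have hs0 : 0 ≤ s := by
        rw [← P.arcStart_zero]
        exact (hmono.monotone (Nat.zero_le k)).trans h1
      have hsL : s < P.period := h2.trans_le (hmono.monotone hk)
      have hu : P.period * Int.fract (s / P.period) = s := by
        rw [Int.fract_eq_self.2 ⟨div_nonneg hs0 hL.le, (div_lt_one hL).2 hsL⟩,
          mul_div_cancel₀ _ hL.ne']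
      have hfind : Nat.findGreatest (fun k => P.arcStart k ≤ s) (n - 1) = k := by
        rw [Nat.findGreatest_eq_iff]
        refine ⟨by omega, fun _ => h1, fun m hm _ hms => ?_⟩
        exact absurd (hmono.monotone (Nat.succ_le_of_lt hm)) (not_le.2 (hms.trans_lt h2))
      simp only [inscribed, hu]
      convert rfl using 3 <;> first | exact hfind.symm | rw [← hfind]
    · obtain ⟨j, rfl⟩ := Nat.exists_eq_add_of_le' hk
      rw [arcStart_add_period] at h1
      rw [add_right_comm, arcStart_add_period] at h2
      have h := ih j (by have := NeZero.pos n; omega) (s := s - P.period) (by linarith)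
        (by linarith)
      rw [← (inscribed_periodic hP) (s - P.period), sub_add_cancel] at h
      rw [h, arcStart_add_period, Nat.cast_add, ZMod.natCast_self, add_zero]
      congr 1
      ring

theorem inscribed_eq (hP : P.dl / Real.sqrt 2 < P.sphereThickness) {k : ℕ} {s : ℝ}
    (hs : s ∈ Set.Icc (P.arcStart k) (P.arcStart (k + 1))) :
    P.inscribed s = P.arc (k : ZMod n) (s - P.arcStart k) := by
  rcases hs.2.lt_or_eq with h | h
  · exact inscribed_eq_of_lt hP hs.1 h
  · have h1 := inscribed_eq_of_lt hP (k := k + 1) h.ge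
      (h.trans_lt (arcStart_strictMono hP (Nat.lt_succ_self _)))
    rw [h1, h, sub_self, arc_zero, arcStart_succ, add_sub_cancel_left, arc_arcLength hP]
    push_cast
    rw [add_sub_cancel_right]

/-! ### Tangent and curvature bound of the inscribed curve -/

theorem hasDerivWithinAt_inscribed (hP : P.dl / Real.sqrt 2 < P.sphereThickness) {k : ℕ} {s : ℝ}
    (hs : s ∈ Set.Icc (P.arcStart k) (P.arcStart (k + 1))) :
    HasDerivWithinAt P.inscribed (P.arcTangent (k : ZMod n) (s - P.arcStart k))
      (Set.Icc (P.arcStart k) (P.arcStart (k + 1))) s :=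
  ((hasDerivAt_arc hP (k : ZMod n) (s - P.arcStart k)).comp_sub_const s
    (P.arcStart k)).hasDerivWithinAt.congr (fun _ ht => inscribed_eq hP ht) (inscribed_eq hP hs)

theorem hasDerivAt_inscribed_arcStart (hP : P.dl / Real.sqrt 2 < P.sphereThickness) (k : ℕ) :
    HasDerivAt P.inscribed (P.edgeDir (k : ZMod n)) (P.arcStart (k + 1)) := by
  have hmono := arcStart_strictMono hP
  have h1 := hmono (Nat.lt_succ_self k)
  have h2 := hmono (Nat.lt_succ_self (k + 1))
  have hl := hasDerivWithinAt_inscribed hP (Set.right_mem_Icc.2 h1.le)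
  have hr := hasDerivWithinAt_inscribed hP (Set.left_mem_Icc.2 h2.le)
  rw [arcStart_succ k, add_sub_cancel_left, arcTangent_arcLength hP, ← arcStart_succ] at hl
  rw [sub_self, arcTangent_zero] at hr
  push_cast at hr
  rw [add_sub_cancel_right] at hr
  have h := hl.union hr
  rw [Set.Icc_union_Icc_eq_Icc h1.le h2.le] at h
  exact h.hasDerivAt (Icc_mem_nhds h1 h2)

theorem hasDerivAt_inscribed (hP : P.dl / Real.sqrt 2 < P.sphereThickness) {k : ℕ} {s : ℝ}
    (hs : s ∈ Set.Icc (P.arcStart k) (P.arcStart (k + 1))) :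
    HasDerivAt P.inscribed (P.arcTangent (k : ZMod n) (s - P.arcStart k)) s := by
  rcases hs.2.lt_or_eq with h2 | h2
  · rcases hs.1.lt_or_eq with h1 | h1
    · exact (hasDerivWithinAt_inscribed hP hs).hasDerivAt (Icc_mem_nhds h1 h2)
    -- The joint at the start of piece `k` is moved one period ahead, so that a preceding piece
    -- exists even when `k = 0`.
    · obtain ⟨m, hm⟩ : ∃ m, k + n = m + 1 := ⟨k + n - 1, by have := NeZero.pos n; omega⟩
      have h := hasDerivAt_inscribed_arcStart hP m
      have hk : (m : ZMod n) = k - 1 := by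
        have := congrArg (Nat.cast : ℕ → ZMod n) hm
        push_cast at this
        rw [ZMod.natCast_self, add_zero] at this
        rw [this, add_sub_cancel_right]
      rw [← hm, arcStart_add_period, hk] at h
      have h3 := h.comp_add_const (P.arcStart k) P.period
      rw [← h1, sub_self, arcTangent_zero]
      refine h3.congr_of_eventuallyEq (Filter.Eventually.of_forall fun x => ?_)
      exact ((inscribed_periodic hP) x).symm
  · rw [h2, arcStart_succ k, add_sub_cancel_left, arcTangent_arcLength hP, ← arcStart_succ]
    exact hasDerivAt_inscribed_arcStart hP k

theorem exists_shift_mem_piece (hP : P.dl / Real.sqrt 2 < P.sphereThickness) (s : ℝ) :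
    ∃ N k : ℕ, P.arcStart k ≤ s + N * P.period ∧ s + N * P.period < P.arcStart (k + 1) := by
  obtain ⟨N, hN⟩ := exists_nat_gt (-s / P.period)
  rw [div_lt_iff₀ (period_pos hP)] at hN
  obtain ⟨k, hk⟩ := exists_mem_piece hP (s := s + N * P.period) (by linarith)
  exact ⟨N, k, hk⟩

theorem differentiable_inscribed (hP : P.dl / Real.sqrt 2 < P.sphereThickness) :
    Differentiable ℝ P.inscribed := by
  intro s
  obtain ⟨N, k, h1, h2⟩ := exists_shift_mem_piece hP s
  have h := (hasDerivAt_inscribed hP ⟨h1, h2.le⟩).comp_add_const s (N * P.period)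
  refine (h.congr_of_eventuallyEq (Filter.Eventually.of_forall fun x => ?_)).differentiableAt
  exact ((inscribed_periodic hP).nat_mul N x).symm

theorem deriv_inscribed_periodic (hP : P.dl / Real.sqrt 2 < P.sphereThickness) :
    Function.Periodic (deriv P.inscribed) P.period := by
  intro s
  rw [← deriv_comp_add_const]
  congr 1
  ext1 x
  exact inscribed_periodic hP x

theorem norm_deriv_inscribed (hP : P.dl / Real.sqrt 2 < P.sphereThickness) (s : ℝ) :
    ‖deriv P.inscribed s‖ = 1 := by
  obtain ⟨N, k, h1, h2⟩ := exists_shift_mem_piece hP s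
  rw [← (deriv_inscribed_periodic hP).nat_mul N s, (hasDerivAt_inscribed hP ⟨h1, h2.le⟩).deriv,
    norm_arcTangent hP]

theorem angle_deriv_inscribed_le_of_mem (hP : P.dl / Real.sqrt 2 < P.sphereThickness) {k : ℕ}
    {s t : ℝ} (hs : s ∈ Set.Icc (P.arcStart k) (P.arcStart (k + 1)))
    (ht : t ∈ Set.Icc (P.arcStart k) (P.arcStart (k + 1))) :
    InnerProductGeometry.angle (deriv P.inscribed s) (deriv P.inscribed t) ≤
      |s - t| / P.minRad := by
  rw [(hasDerivAt_inscribed hP hs).deriv, (hasDerivAt_inscribed hP ht).deriv]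
  have h := angle_arcTangent_le hP (k : ZMod n) (s - P.arcStart k) (t - P.arcStart k)
  rwa [sub_sub_sub_cancel_right] at h

theorem angle_deriv_inscribed_le_of_nonneg (hP : P.dl / Real.sqrt 2 < P.sphereThickness)
    {s t : ℝ} (hs : 0 ≤ s) (hst : s ≤ t) :
    InnerProductGeometry.angle (deriv P.inscribed s) (deriv P.inscribed t) ≤
      (t - s) / P.minRad := by
  obtain ⟨j, hj1, hj2⟩ := exists_mem_piece hP hs
  obtain ⟨k, hk1, hk2⟩ := exists_mem_piece hP (hs.trans hst)
  have hmono := arcStart_strictMono hP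
  have hjk : j ≤ k := by
    have := hmono.lt_iff_lt.1 (hj1.trans_lt (hst.trans_lt hk2))
    omega
  obtain ⟨d, rfl⟩ := Nat.exists_eq_add_of_le hjk
  clear hjk
  -- With the weak inequality the induction hypothesis applies at the joint itself, where the next
  -- piece begins.
  replace hk2 := hk2.le
  induction d generalizing t with
  | zero =>
    have h := angle_deriv_inscribed_le_of_mem hP ⟨hj1, hj2.le⟩ ⟨hk1, hk2⟩
    rwa [abs_of_nonpos (by linarith), neg_sub] at h
  | succ d ih =>
    rw [← add_assoc] at hk1 hk2
    have hle : s ≤ P.arcStart (j + d + 1) :=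
      hj2.le.trans (hmono.monotone (by omega))
    have h1 := ih hle (hmono.monotone (Nat.le_succ _)) le_rfl
    have h2 := angle_deriv_inscribed_le_of_mem hP
      (Set.left_mem_Icc.2 (hmono.monotone (Nat.le_succ (j + d + 1)))) ⟨hk1, hk2⟩
    rw [abs_sub_comm, abs_of_nonneg (sub_nonneg.2 hk1)] at h2
    refine (InnerProductGeometry.angle_le_angle_add_angle _ _ _).trans
      ((add_le_add h1 h2).trans (le_of_eq ?_))
    rw [← add_div]
    congr 1
    ring

theorem angle_deriv_inscribed_le (hP : P.dl / Real.sqrt 2 < P.sphereThickness) (s t : ℝ) :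
    InnerProductGeometry.angle (deriv P.inscribed s) (deriv P.inscribed t) ≤
      |s - t| / P.minRad := by
  wlog hst : s ≤ t generalizing s t
  · rw [InnerProductGeometry.angle_comm, abs_sub_comm]
    exact this t s (le_of_not_ge hst)
  obtain ⟨N, hN⟩ := exists_nat_gt (-s / P.period)
  rw [div_lt_iff₀ (period_pos hP)] at hN
  have h := angle_deriv_inscribed_le_of_nonneg hP (s := s + N * P.period) (t := t + N * P.period)
    (by linarith) (by linarith)
  rwa [(deriv_inscribed_periodic hP).nat_mul N, (deriv_inscribed_periodic hP).nat_mul N,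
    add_sub_add_right_eq_sub, ← abs_of_nonneg (sub_nonneg.2 hst), abs_sub_comm] at h

theorem _root_.InnerProductGeometry.norm_sub_le_angle {V : Type*} [NormedAddCommGroup V]
    [InnerProductSpace ℝ V] {x y : V} (hx : ‖x‖ = 1) (hy : ‖y‖ = 1) :
    ‖x - y‖ ≤ InnerProductGeometry.angle x y := by
  refine le_of_sq_le_sq ?_ (InnerProductGeometry.angle_nonneg _ _)
  have h := Real.one_sub_sq_div_two_le_cos (x := InnerProductGeometry.angle x y)
  rw [InnerProductGeometry.cos_angle, hx, hy] at h
  rw [norm_sub_sq_real, hx, hy]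
  linarith

theorem lipschitzWith_deriv_inscribed (hP : P.dl / Real.sqrt 2 < P.sphereThickness) :
    LipschitzWith (Real.toNNReal P.minRad⁻¹) (deriv P.inscribed) := by
  refine LipschitzWith.of_dist_le_mul fun s t => ?_
  rw [Real.coe_toNNReal _ (inv_nonneg.2 P.minRad_nonneg), dist_eq_norm, Real.dist_eq,
    inv_mul_eq_div]
  exact (InnerProductGeometry.norm_sub_le_angle (norm_deriv_inscribed hP s)
    (norm_deriv_inscribed hP t)).trans (angle_deriv_inscribed_le hP s t)

theorem contDiff_inscribed (hP : P.dl / Real.sqrt 2 < P.sphereThickness) :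
    ContDiff ℝ 1 P.inscribed :=
  contDiff_one_iff_deriv.2
    ⟨differentiable_inscribed hP, (lipschitzWith_deriv_inscribed hP).continuous⟩

end EquilateralKnot

/-! ### Normal disks at nearby points of a curve of bounded curvature -/

/-- Only the component of `x` orthogonal to `y` pairs with `w`, and its length is at most `sin φ`.
-/
theorem inner_le_sin_mul_norm {V : Type*} [NormedAddCommGroup V] [InnerProductSpace ℝ V]
    {x y w : V} (hx : ‖x‖ = 1) (hy : ‖y‖ = 1) (hw : ⟪y, w⟫ = 0) {φ : ℝ} (h0 : 0 ≤ φ)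
    (h1 : φ ≤ Real.pi / 2) (hφ : Real.cos φ ≤ ⟪x, y⟫) : ⟪x, w⟫ ≤ Real.sin φ * ‖w‖ := by
  have hs : 0 ≤ Real.sin φ := Real.sin_nonneg_of_nonneg_of_le_pi h0 (by linarith [Real.pi_pos])
  have hc : 0 ≤ Real.cos φ := Real.cos_nonneg_of_mem_Icc ⟨by linarith, h1⟩
  have h2 : ⟪x, w⟫ = ⟪x - ⟪x, y⟫ • y, w⟫ := by
    rw [inner_sub_left, inner_smul_left, hw, mul_zero, sub_zero]
  have h3 : ‖x - ⟪x, y⟫ • y‖ ^ 2 = 1 - ⟪x, y⟫ ^ 2 := by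
    rw [norm_sub_sq_real, inner_smul_right, norm_smul, hx, hy, Real.norm_eq_abs, mul_one, sq_abs]
    ring
  have h4 : ‖x - ⟪x, y⟫ • y‖ ≤ Real.sin φ := by
    refine le_of_sq_le_sq ?_ hs
    rw [h3, Real.sin_sq]
    linarith [pow_le_pow_left₀ hc hφ 2]
  rw [h2]
  exact (real_inner_le_norm _ _).trans (mul_le_mul_of_nonneg_right h4 (norm_nonneg w))

theorem disjoint_normalDisk_of_angle_le {γ : ℝ → E3} (hγ : Differentiable ℝ γ)
    (hunit : ∀ s, ‖deriv γ s‖ = 1) {R : ℝ} (hR : 0 < R)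
    (hangle : ∀ s t, InnerProductGeometry.angle (deriv γ s) (deriv γ t) ≤ |s - t| / R)
    {r a b : ℝ} (hr : r < R) (hab : a < b) (hba : b - a ≤ Real.pi * R) :
    Disjoint (normalDisk γ r a) (normalDisk γ r b) := by
  rw [Set.disjoint_left]
  rintro p ⟨ha1, ha2⟩ ⟨hb1, hb2⟩
  -- Everything is projected onto the tangent at the middle parameter, from which the tangent turns
  -- by at most `φ ≤ π / 2` towards either end.
  set u := (a + b) / 2 with hu
  set φ := (b - a) / 2 / R with hφ
  have hφ0 : 0 < φ := div_pos (by linarith) hR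
  have hφ1 : φ ≤ Real.pi / 2 := by
    rw [hφ, div_le_iff₀ hR]
    linarith
  have hφR : R * φ = (b - a) / 2 := mul_div_cancel₀ _ hR.ne'
  have hcos : ∀ v ∈ Set.Icc a b, Real.cos ((v - u) / R) ≤ ⟪deriv γ u, deriv γ v⟫ := by
    intro v hv
    have h1 : |u - v| / R ≤ Real.pi := by
      have : |u - v| ≤ (b - a) / 2 := abs_le.2 ⟨by linarith [hv.2], by linarith [hv.1]⟩
      rw [div_le_iff₀ hR]
      linarith [Real.pi_pos]
    have h2 := Real.cos_le_cos_of_nonneg_of_le_pi (InnerProductGeometry.angle_nonneg _ _) h1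
      (hangle u v)
    rw [InnerProductGeometry.cos_angle, hunit, hunit, mul_one, div_one] at h2
    rwa [← Real.cos_abs, abs_div, abs_of_pos hR, abs_sub_comm]
  have hderiv : ∀ v, HasDerivAt (fun v => ⟪deriv γ u, γ v⟫ - R * Real.sin ((v - u) / R))
      (⟪deriv γ u, deriv γ v⟫ - Real.cos ((v - u) / R)) v := by
    intro v
    have h1 : HasDerivAt (fun v => ⟪deriv γ u, γ v⟫) ⟪deriv γ u, deriv γ v⟫ v := by
      simpa using (hasDerivAt_const v (deriv γ u)).inner ℝ (hγ v).hasDerivAt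
    have h2 : HasDerivAt (fun v => (v - u) / R) (1 / R) v :=
      ((hasDerivAt_id v).sub_const u).div_const R
    refine (h1.sub (h2.sin.const_mul R)).congr_deriv ?_
    field_simp
  -- The curve advances in the direction of its middle tangent at least as fast as a circle of
  -- radius `R` does.
  have hmono : MonotoneOn (fun v => ⟪deriv γ u, γ v⟫ - R * Real.sin ((v - u) / R))
      (Set.Icc a b) := by
    refine monotoneOn_of_deriv_nonneg (convex_Icc a b)
      (fun v _ => (hderiv v).continuousAt.continuousWithinAt)
      (fun v _ => (hderiv v).differentiableAt.differentiableWithinAt) fun v hv => ?_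
    rw [(hderiv v).deriv]
    exact sub_nonneg.2 (hcos v (interior_subset hv))
  have hlow := hmono (Set.left_mem_Icc.2 hab.le) (Set.right_mem_Icc.2 hab.le) hab.le
  have ea : (a - u) / R = -φ := by rw [hφ, hu]; ring
  have eb : (b - u) / R = φ := by rw [hφ, hu]; ring
  simp only [ea, eb, Real.sin_neg] at hlow
  have hca := hcos a (Set.left_mem_Icc.2 hab.le)
  have hcb := hcos b (Set.right_mem_Icc.2 hab.le)
  rw [ea, Real.cos_neg] at hca
  rw [eb] at hcb
  have hs : 0 < Real.sin φ := Real.sin_pos_of_pos_of_lt_pi hφ0 (by linarith [Real.pi_pos])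
  rw [dist_eq_norm] at ha1 hb1
  have h1 := inner_le_sin_mul_norm (hunit u) (hunit a) ha2 hφ0.le hφ1 hca
  have h2 := inner_le_sin_mul_norm (w := γ b - p) (hunit u) (hunit b)
    (by rw [← neg_sub, inner_neg_right, hb2, neg_zero]) hφ0.le hφ1 hcb
  rw [norm_sub_rev] at h2
  rw [inner_sub_right] at h1 h2
  -- A common point `p` would give `2 R sin φ ≤ ⟪γ' u, γ b - γ a⟫ ≤ 2 r sin φ`, although `r < R`.
  nlinarith [mul_le_mul_of_nonneg_left ha1 hs.le, mul_le_mul_of_nonneg_left hb1 hs.le,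
    mul_pos hs (sub_pos.2 hr)]

namespace EquilateralKnot

variable {n : ℕ} [NeZero n] {P : EquilateralKnot n}

/-! ### The normal disks along an inscribed arc lie in a ball around the vertex -/

/-- Multiplied by `cos (θ / 2)`, this is `cos (θ / 2) ≤ cos (ψ - θ / 2)`. -/
theorem tan_half_mul_sin_ge {θ ψ : ℝ} (hθ : 0 ≤ θ) (hθ' : θ < Real.pi) (h0 : 0 ≤ ψ)
    (h1 : ψ ≤ θ) : 1 - Real.cos ψ ≤ Real.tan (θ / 2) * Real.sin ψ := by
  have hc : 0 < Real.cos (θ / 2) := Real.cos_pos_of_mem_Ioo ⟨by linarith, by linarith⟩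
  have h2 : Real.cos (θ / 2) ≤ Real.cos (ψ - θ / 2) := by
    rw [← Real.cos_abs (ψ - θ / 2)]
    exact Real.cos_le_cos_of_nonneg_of_le_pi (abs_nonneg _) (by linarith)
      (abs_le.2 ⟨by linarith, by linarith⟩)
  rw [Real.cos_sub] at h2
  rw [Real.tan_eq_sin_div_cos, div_mul_eq_mul_div, le_div_iff₀ hc]
  linarith

theorem half_dl_eq (hP : P.dl / Real.sqrt 2 < P.sphereThickness) {i : ZMod n}
    (hi : P.turningAngle i ≠ 0) : P.dl / 2 = P.rad i * Real.tan (P.turningAngle i / 2) := by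
  have := (tan_half_turningAngle_pos hP hi).ne'
  rw [rad]
  field_simp

/-- On a curved arc, with `a` the component of `y` along the inward normal, the squared distance is
`‖y‖² + (dl/2)² - 2 (ρ - a) (dl/2 · sin ψ - ρ (1 - cos ψ))`. Both factors are nonnegative: the first
because `a ≤ ‖y‖ ≤ MinRad ≤ ρ`, the second by `tan_half_mul_sin_ge`. -/
theorem norm_arc_add_sub_vertex_sq_le (hP : P.dl / Real.sqrt 2 < P.sphereThickness) (i : ZMod n)
    {t : ℝ} (ht : t ∈ Set.Icc 0 (P.arcLength i)) {y : E3} (hy : ⟪P.arcTangent i t, y⟫ = 0)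
    (hyR : ‖y‖ ≤ P.minRad) :
    ‖P.arc i t + y - P.vertex i‖ ^ 2 ≤ ‖y‖ ^ 2 + (P.dl / 2) ^ 2 := by
  by_cases hi : P.turningAngle i = 0
  · have hT : P.arcTangent i t = P.edgeDir (i - 1) := by
      simp [arcTangent, rad_of_turningAngle_eq_zero hi]
    rw [hT] at hy
    rw [arcLength_of_eq hi] at ht
    have h : P.arc i t + y - P.vertex i = (t - P.dl / 2) • P.edgeDir (i - 1) + y := by
      rw [arc, if_pos hi, midpoint_eq]
      module
    rw [h, norm_add_sq_real, inner_smul_left, hy, norm_smul, norm_edgeDir, mul_one,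
      Real.norm_eq_abs, sq_abs]
    nlinarith [mul_nonneg ht.1 (sub_nonneg.2 ht.2)]
  · rw [arcLength_of_ne hi] at ht
    have hr := rad_pos hP hi
    set ρ := P.rad i with hρ
    set ψ := t / ρ with hψ
    have hψ0 : 0 ≤ ψ := div_nonneg ht.1 hr.le
    have hψ1 : ψ ≤ P.turningAngle i := by
      rw [hψ, div_le_iff₀ hr, mul_comm]
      exact ht.2
    have hτ : P.dl / 2 = ρ * Real.tan (P.turningAngle i / 2) := half_dl_eq hP hi
    have hQ := tan_half_mul_sin_ge (P.turningAngle_nonneg i)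
      ((turningAngle_lt hP i).trans (by linarith [Real.pi_pos])) hψ0 hψ1
    replace hQ := mul_le_mul_of_nonneg_left hQ hr.le
    rw [← mul_assoc, ← hτ] at hQ
    have hsc := Real.sin_sq_add_cos_sq ψ
    have hρy : ‖y‖ ≤ ρ := hyR.trans (minRad_le_rad hP hi)
    have h : P.arc i t + y - P.vertex i =
        ((ρ * Real.sin ψ - P.dl / 2) • P.edgeDir (i - 1) +
          (ρ * (1 - Real.cos ψ)) • P.cornerNormal i) + y := by
      rw [arc, if_neg hi, midpoint_eq, ← hρ, ← hψ]
      module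
    have h' := P.inner_edgeDir_cornerNormal i
    have h2 : ⟪P.cornerNormal i, P.edgeDir (i - 1)⟫ = 0 := by rw [real_inner_comm, h']
    have hN := inner_cornerNormal_self hP hi
    rw [arcTangent, inner_add_left, inner_smul_left, inner_smul_left, ← hψ] at hy
    simp only [conj_trivial] at hy
    set c := Real.cos ψ
    set s := Real.sin ψ
    set y₁ := ⟪P.edgeDir (i - 1), y⟫
    set y₂ := ⟪P.cornerNormal i, y⟫
    have ha : c * y₂ - s * y₁ ≤ ‖y‖ := by
      have h3 := real_inner_le_norm (c • P.cornerNormal i - s • P.edgeDir (i - 1)) y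
      have h4 : ‖c • P.cornerNormal i - s • P.edgeDir (i - 1)‖ = 1 := by
        rw [← pow_eq_one_iff_of_nonneg (norm_nonneg _) two_ne_zero, ← real_inner_self_eq_norm_sq]
        simp only [inner_sub_left, inner_sub_right, inner_smul_left, inner_smul_right,
          inner_edgeDir_self, h', h2, hN, conj_trivial]
        linarith
      rw [h4, one_mul, inner_sub_left, inner_smul_left, inner_smul_left] at h3
      exact h3
    rw [h, ← real_inner_self_eq_norm_sq, ← real_inner_self_eq_norm_sq]
    rw [real_inner_add_add_self]
    simp only [inner_add_left, inner_add_right, inner_smul_left, inner_smul_right,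
      inner_edgeDir_self, h', h2, hN, conj_trivial]
    -- As `y` is orthogonal to the tangent, its part in the corner plane is `a` times the unit
    -- normal `(-s, c)`.
    have e1 : y₁ = -s * (c * y₂ - s * y₁) := by linear_combination (-y₁) * hsc + c * hy
    have e2 : y₂ = c * (c * y₂ - s * y₁) := by linear_combination (-y₂) * hsc + s * hy
    set a := c * y₂ - s * y₁
    have key : 0 ≤ (ρ - a) * (P.dl / 2 * s - ρ * (1 - c)) :=
      mul_nonneg (by linarith) (by linarith)
    have e3 : (ρ * s - P.dl / 2) ^ 2 + (ρ * (1 - c)) ^ 2 +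
        2 * ((ρ * s - P.dl / 2) * y₁ + ρ * (1 - c) * y₂) =
        (P.dl / 2) ^ 2 - 2 * ((ρ - a) * (P.dl / 2 * s - ρ * (1 - c))) := by
      linear_combination (ρ ^ 2 - 2 * a * ρ) * hsc + 2 * (ρ * s - P.dl / 2) * e1 +
        2 * (ρ * (1 - c)) * e2
    change (ρ * s - P.dl / 2) * ((ρ * s - P.dl / 2) * 1 + ρ * (1 - c) * 0) +
          ρ * (1 - c) * ((ρ * s - P.dl / 2) * 0 + ρ * (1 - c) * 1) +
        2 * ((ρ * s - P.dl / 2) * y₁ + ρ * (1 - c) * y₂) + ⟪y, y⟫ ≤ ⟪y, y⟫ + (P.dl / 2) ^ 2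
    linarith

theorem dist_vertex_sq_le_of_mem_normalDisk (hP : P.dl / Real.sqrt 2 < P.sphereThickness)
    {k : ℕ} {s r : ℝ} (hs : s ∈ Set.Icc (P.arcStart k) (P.arcStart (k + 1)))
    (hr : r ≤ P.minRad) {p : E3} (hp : p ∈ normalDisk P.inscribed r s) :
    dist p (P.vertex (k : ZMod n)) ^ 2 ≤ r ^ 2 + (P.dl / 2) ^ 2 := by
  obtain ⟨h1, h2⟩ := hp
  rw [(hasDerivAt_inscribed hP hs).deriv] at h2
  have h := norm_arc_add_sub_vertex_sq_le hP (k : ZMod n) (t := s - P.arcStart k)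
    ⟨by linarith [hs.1], by
      have := hs.2
      rw [arcStart_succ] at this
      linarith⟩ h2 (by rw [← dist_eq_norm]; exact h1.trans hr)
  rw [dist_eq_norm] at h1 ⊢
  rw [← inscribed_eq hP hs, add_sub_cancel] at h
  linarith [pow_le_pow_left₀ (norm_nonneg _) h1 2]

/-! ### The thickness radius of the inscribed curve -/

theorem normalDisk_add_period (hP : P.dl / Real.sqrt 2 < P.sphereThickness) (r s : ℝ) :
    normalDisk P.inscribed r (s + P.period) = normalDisk P.inscribed r s := by
  rw [normalDisk, normalDisk, inscribed_periodic hP, deriv_inscribed_periodic hP]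

theorem two_mul_sphereThickness_le_dist {i j : ZMod n}
    (h : ⌈Real.pi * P.minRad / P.dl - 1⌉ ≤ (indexDist i j : ℤ)) :
    2 * P.sphereThickness ≤ dist (P.vertex i) (P.vertex j) := by
  have h1 : sInf {d : ℝ | ∃ i j : ZMod n,
      ⌈Real.pi * P.minRad / P.dl - 1⌉ ≤ (indexDist i j : ℤ) ∧
      d = dist (P.vertex i) (P.vertex j)} ≤ dist (P.vertex i) (P.vertex j) := by
    refine csInf_le ⟨0, ?_⟩ ⟨i, j, h, rfl⟩
    rintro _ ⟨i, j, -, rfl⟩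
    exact dist_nonneg
  have h2 : P.sphereThickness ≤ P.sphereRadius := min_le_right _ _
  rw [sphereRadius] at h2
  linarith

/-- The `- 1` inside the ceiling pays for the extra arc: index distance `d` involves `d + 1` arcs,
both end arcs included. -/
theorem succ_indexDist_mul_dl_lt {i j : ZMod n}
    (h : (indexDist i j : ℤ) < ⌈Real.pi * P.minRad / P.dl - 1⌉) :
    ((indexDist i j : ℝ) + 1) * P.dl < Real.pi * P.minRad := by
  rw [Int.lt_ceil, Int.cast_natCast, lt_sub_iff_add_lt, lt_div_iff₀ P.dl_pos] at h
  exact h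

theorem indexDist_natCast {i j : ℕ} (hij : i ≤ j) (hj : j < n) :
    indexDist (j : ZMod n) (i : ZMod n) = min (j - i) (n - (j - i)) := by
  rw [indexDist, ← Nat.cast_sub hij, ZMod.valMinAbs_natAbs_eq_min, ZMod.val_natCast,
    Nat.mod_eq_of_lt (by omega)]

theorem disjoint_normalDisk (hP : P.dl / Real.sqrt 2 < P.sphereThickness) {r : ℝ}
    (hr0 : 0 ≤ r) (hr : r < P.circleRadius) {s t : ℝ} (hs : 0 ≤ s) (hst : s < t)
    (ht : t < P.period) :
    Disjoint (normalDisk P.inscribed r s) (normalDisk P.inscribed r t) := by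
  have hrR : r < P.minRad := hr.trans_le (circleRadius_le_minRad hP)
  have hmono := arcStart_strictMono hP
  obtain ⟨i, hi1, hi2⟩ := exists_mem_piece hP hs
  obtain ⟨j, hj1, hj2⟩ := exists_mem_piece hP (hs.trans hst.le)
  have hij : i ≤ j := by
    have := hmono.lt_iff_lt.1 (hi1.trans_lt (hst.trans hj2))
    omega
  have hjn : j < n := hmono.lt_iff_lt.1 (hj1.trans_lt ht)
  have hnear : ∀ {a b : ℝ}, a < b → b - a ≤ Real.pi * P.minRad →
      Disjoint (normalDisk P.inscribed r a) (normalDisk P.inscribed r b) :=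
    disjoint_normalDisk_of_angle_le (differentiable_inscribed hP) (norm_deriv_inscribed hP)
      (minRad_pos hP) (angle_deriv_inscribed_le hP) hrR
  rcases le_or_gt ⌈Real.pi * P.minRad / P.dl - 1⌉
    (indexDist (j : ZMod n) (i : ZMod n) : ℤ) with h | h
  · rw [Set.disjoint_left]
    intro p hp hp'
    have hball : ∀ {k : ℕ} {u : ℝ}, P.arcStart k ≤ u → u < P.arcStart (k + 1) →
        p ∈ normalDisk P.inscribed r u → dist p (P.vertex (k : ZMod n)) < P.sphereThickness := by
      intro k u h1 h2 hpu
      refine lt_of_pow_lt_pow_left₀ 2 (sphereThickness_pos hP).le ?_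
      have h3 := dist_vertex_sq_le_of_mem_normalDisk hP ⟨h1, h2.le⟩ hrR.le hpu
      have h4 := circleRadius_sq hP
      have h5 := pow_lt_pow_left₀ hr hr0 two_ne_zero
      linarith
    have h1 := hball hi1 hi2 hp
    have h2 := hball hj1 hj2 hp'
    have h3 := dist_triangle_left (P.vertex (j : ZMod n)) (P.vertex (i : ZMod n)) p
    linarith [two_mul_sphereThickness_le_dist h]
  · have h' := succ_indexDist_mul_dl_lt h
    rw [indexDist_natCast hij hjn] at h'
    rcases min_choice (j - i) (n - (j - i)) with hm | hm
    · rw [hm] at h'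
      have h1 := arcStart_le hP i (j - i + 1)
      rw [show i + (j - i + 1) = j + 1 by omega] at h1
      push_cast at h1
      exact hnear hst (by linarith)
    -- The short way round passes the base point, so `s` is replaced by `s + period`.
    · rw [hm] at h'
      have h1 := arcStart_le hP j (n - (j - i) + 1)
      rw [show j + (n - (j - i) + 1) = i + 1 + n by omega, arcStart_add_period] at h1
      push_cast at h1
      have h2 := hnear (a := t) (b := s + P.period) (by linarith) (by linarith)
      rw [normalDisk_add_period hP] at h2
      exact h2.symm

theorem disjoint_normalDisk_of_ne (hP : P.dl / Real.sqrt 2 < P.sphereThickness) {r : ℝ}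
    (hr0 : 0 ≤ r) (hr : r < P.circleRadius) {s t : ℝ} (hs : s ∈ Set.Ico 0 P.period)
    (ht : t ∈ Set.Ico 0 P.period) (hst : s ≠ t) :
    Disjoint (normalDisk P.inscribed r s) (normalDisk P.inscribed r t) := by
  rcases hst.lt_or_gt with h | h
  · exact disjoint_normalDisk hP hr0 hr hs.1 h ht.2
  · exact (disjoint_normalDisk hP hr0 hr ht.1 h hs.2).symm

theorem isC11Knot_inscribed (hP : P.dl / Real.sqrt 2 < P.sphereThickness) :
    IsC11Knot P.inscribed P.period := by
  refine ⟨⟨period_pos hP, inscribed_periodic hP, contDiff_inscribed hP, fun s h => ?_, ?_⟩,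
    _, lipschitzWith_deriv_inscribed hP⟩
  · have h1 := norm_deriv_inscribed hP s
    rw [h, norm_zero] at h1
    exact zero_ne_one h1
  · intro s hs t ht hst
    by_contra hne
    -- Disks of radius `0` already contain their centres, so disjointness forces injectivity.
    refine Set.disjoint_left.1 (disjoint_normalDisk_of_ne hP le_rfl (circleRadius_pos hP) hs ht hne)
      (show P.inscribed s ∈ _ from ⟨by simp, by simp⟩) ⟨by simp [hst], by simp [hst]⟩

/-- Only radii strictly below `R_c` are shown admissible; the supremum needs no more. -/
theorem circleRadius_le_thickness (hP : P.dl / Real.sqrt 2 < P.sphereThickness) :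
    ENNReal.ofReal P.circleRadius ≤ thickness P.inscribed P.period := by
  refine le_of_forall_lt fun c hc => ?_
  have hc' : c ≠ ⊤ := ne_top_of_lt hc
  have h1 : c.toReal < P.circleRadius := (ENNReal.lt_ofReal_iff_toReal_lt hc').1 hc
  have h2 := exists_between h1
  obtain ⟨r, hr1, hr2⟩ := h2
  have hr0 : 0 < r := ENNReal.toReal_nonneg.trans_lt hr1
  refine ((ENNReal.lt_ofReal_iff_toReal_lt hc').2 hr1).trans_le (le_sSup ⟨r, ⟨hr0, ?_⟩, rfl⟩)
  exact fun s hs t ht hst => disjoint_normalDisk_of_ne hP hr0.le hr2 hs ht hst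

theorem ropelength_inscribed_le (hP : P.dl / Real.sqrt 2 < P.sphereThickness) :
    ropelength P.inscribed P.period ≤
      ENNReal.ofReal (length P.inscribed P.period / P.circleRadius) := by
  rw [ropelength, ENNReal.ofReal_div_of_pos (circleRadius_pos hP)]
  exact ENNReal.div_le_div_left (circleRadius_le_thickness hP) _

end EquilateralKnot

/-! ### Points in the triangle cut off by a corner -/

section Corner

variable {V : Type*} [NormedAddCommGroup V] [InnerProductSpace ℝ V] {e f : V}

theorem norm_smul_sub_le_of_unit (he : ‖e‖ = 1) (hf : ‖f‖ = 1) (g : ℝ) :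
    ‖g • (f - e)‖ ≤ 2 * |g| := by
  rw [norm_smul, Real.norm_eq_abs, mul_comm]
  have := norm_sub_le f e
  exact mul_le_mul_of_nonneg_right (by linarith) (abs_nonneg g)

/-- Pairing the difference of positions with `e + f` leaves `(a - a') + (b - b')` times `1 + ⟪e, f⟫
≥ 1`, whatever `μ` is. As the two differences have the same sign, this sum also bounds the change of
the minimum. The constant is `2 · 2`, from `‖f - e‖ ≤ 2` and `‖e + f‖ ≤ 2`. -/
theorem norm_corner_displacement_sub_le (he : ‖e‖ = 1) (hf : ‖f‖ = 1) (hef : 0 ≤ ⟪e, f⟫)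
    {a b a' b' τ : ℝ} (hab : 0 ≤ (a - a') * (b - b')) (μ : ℝ) :
    ‖min b (τ - a) • (f - e) - min b' (τ - a') • (f - e)‖ ≤
      4 * ‖((a + μ * min b (τ - a)) • e + (b - μ * min b (τ - a)) • f) -
        ((a' + μ * min b' (τ - a')) • e + (b' - μ * min b' (τ - a')) • f)‖ := by
  set g := min b (τ - a) - min b' (τ - a') with hg
  set Z := ((a + μ * min b (τ - a)) • e + (b - μ * min b (τ - a)) • f) -
    ((a' + μ * min b' (τ - a')) • e + (b' - μ * min b' (τ - a')) • f) with hZ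
  have hZ' : Z = ((a - a') + μ * g) • e + ((b - b') - μ * g) • f := by
    rw [hZ, hg]
    module
  have h1 : |g| ≤ |(a - a') + (b - b')| := by
    have h2 : |g| ≤ max |b - b'| |τ - a - (τ - a')| := abs_min_sub_min_le_max _ _ _ _
    rw [sub_sub_sub_cancel_left, abs_sub_comm a' a] at h2
    have h3 : |(a - a') + (b - b')| = |a - a'| + |b - b'| := by
      rw [abs_add_eq_add_abs_iff]
      rcases mul_nonneg_iff.1 hab with h | h
      · exact Or.inl h
      · exact Or.inr h
    rw [h3]
    exact h2.trans (max_le (le_add_of_nonneg_left (abs_nonneg _))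
      (le_add_of_nonneg_right (abs_nonneg _)))
  have h2 : ⟪Z, e + f⟫ = ((a - a') + (b - b')) * (1 + ⟪e, f⟫) := by
    rw [hZ']
    simp only [inner_add_left, inner_add_right, inner_smul_left, conj_trivial,
      real_inner_self_eq_norm_sq, he, hf, real_inner_comm e f]
    ring
  have h3 : |(a - a') + (b - b')| ≤ 2 * ‖Z‖ := by
    have h4 := abs_real_inner_le_norm Z (e + f)
    rw [h2, abs_mul, abs_of_nonneg (by linarith : 0 ≤ 1 + ⟪e, f⟫)] at h4
    have h5 := norm_add_le e f
    rw [he, hf] at h5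
    nlinarith [abs_nonneg ((a - a') + (b - b')), norm_nonneg Z,
      mul_le_mul_of_nonneg_left h5 (norm_nonneg Z),
      mul_nonneg (abs_nonneg ((a - a') + (b - b'))) hef]
  rw [← sub_smul]
  linarith [norm_smul_sub_le_of_unit he hf g]

/-- The norm is at most `a + b ≤ 2 a`, and the acute angle makes the component along `e` at least
`a`. Such points fill a cone around `e`. -/
theorem norm_le_two_mul_inner (he : ‖e‖ = 1) (hf : ‖f‖ = 1) (hef : 0 ≤ ⟪e, f⟫) {a b : ℝ}
    (hb : 0 ≤ b) (hba : b ≤ a) : ‖a • e + b • f‖ ≤ 2 * ⟪a • e + b • f, e⟫ := by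
  have h := norm_add_le (a • e) (b • f)
  rw [norm_smul, norm_smul, he, hf, Real.norm_of_nonneg hb, Real.norm_of_nonneg (hb.trans hba)]
    at h
  rw [inner_add_left, inner_smul_left, inner_smul_left, real_inner_self_eq_norm_sq, he,
    real_inner_comm]
  simp only [conj_trivial]
  nlinarith [mul_nonneg hb hef]

end Corner

namespace EquilateralKnot

variable {n : ℕ} [NeZero n] {P : EquilateralKnot n}

/-! ### Coordinates along the inscribed arcs -/

/-- For a curved arc with `ψ = t / ρ`, the coordinates are `ρ / sin θ` times `cos (θ - ψ) - cos θ`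
and `1 - cos ψ`. The inequality `β ≤ α` is again `tan_half_mul_sin_ge`. -/
theorem exists_corner_coordinates (hP : P.dl / Real.sqrt 2 < P.sphereThickness) (i : ZMod n) :
    ∃ α β : ℝ → ℝ, MonotoneOn α (Set.Icc 0 (P.arcLength i)) ∧
      MonotoneOn β (Set.Icc 0 (P.arcLength i)) ∧ Continuous α ∧ Continuous β ∧
      α 0 = 0 ∧ β 0 = 0 ∧ α (P.arcLength i) = P.dl / 2 ∧ β (P.arcLength i) = P.dl / 2 ∧
      (∀ t ∈ Set.Icc 0 (P.arcLength i), β t ≤ α t) ∧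
      ∀ t, P.arc i t = P.vertex i - (P.dl / 2) • P.edgeDir (i - 1) +
        (α t • P.edgeDir (i - 1) + β t • P.edgeDir i) := by
  by_cases hi : P.turningAngle i = 0
  · have hm : Monotone fun t : ℝ => t / 2 := fun a b hab => div_le_div_of_nonneg_right hab two_pos.le
    refine ⟨fun t => t / 2, fun t => t / 2, hm.monotoneOn _, hm.monotoneOn _, by fun_prop,
      by fun_prop, by simp, by simp, by simp [arcLength_of_eq hi], by simp [arcLength_of_eq hi],
      fun _ _ => le_rfl, fun t => ?_⟩
    rw [arc, if_pos hi, midpoint_eq, edgeDir_eq_of_eq hi]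
    module
  · have hr := rad_pos hP hi
    have hs := sin_turningAngle_pos hP hi
    obtain ⟨e1, e2⟩ := rad_mul_sin_cos hP hi
    have hτ := half_dl_eq hP hi
    have hθπ : P.turningAngle i < Real.pi := (turningAngle_lt hP i).trans (by linarith [Real.pi_pos])
    have hψ : ∀ t ∈ Set.Icc 0 (P.arcLength i),
        0 ≤ t / P.rad i ∧ t / P.rad i ≤ P.turningAngle i := by
      intro t ht
      rw [arcLength_of_ne hi] at ht
      exact ⟨div_nonneg ht.1 hr.le, by rw [div_le_iff₀ hr, mul_comm]; exact ht.2⟩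
    have hκ : 0 ≤ P.rad i / Real.sin (P.turningAngle i) := (div_pos hr hs).le
    have hend : P.arcLength i / P.rad i = P.turningAngle i := by
      rw [arcLength_of_ne hi, mul_div_cancel_left₀ _ hr.ne']
    have hhalf : P.rad i / Real.sin (P.turningAngle i) * (1 - Real.cos (P.turningAngle i)) =
        P.dl / 2 := by
      rw [div_mul_eq_mul_div, e2, mul_div_cancel_right₀ _ hs.ne']
    refine ⟨fun t => P.rad i / Real.sin (P.turningAngle i) *
        (Real.cos (P.turningAngle i - t / P.rad i) - Real.cos (P.turningAngle i)),
      fun t => P.rad i / Real.sin (P.turningAngle i) * (1 - Real.cos (t / P.rad i)),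
      ?_, ?_, by fun_prop, by fun_prop, by simp, by simp, ?_, ?_, ?_, ?_⟩
    · intro s hs' t ht hst
      have h1 := hψ s hs'
      have h2 := hψ t ht
      have h3 := div_le_div_of_nonneg_right hst hr.le
      refine mul_le_mul_of_nonneg_left (sub_le_sub_right ?_ _) hκ
      exact Real.cos_le_cos_of_nonneg_of_le_pi (by linarith) (by linarith) (by linarith)
    · intro s hs' t ht hst
      have h1 := hψ s hs'
      have h2 := hψ t ht
      have h3 := div_le_div_of_nonneg_right hst hr.le
      refine mul_le_mul_of_nonneg_left (sub_le_sub_left ?_ _) hκ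
      exact Real.cos_le_cos_of_nonneg_of_le_pi (by linarith) (by linarith) (by linarith)
    · simp only [hend, sub_self, Real.cos_zero, hhalf]
    · simp only [hend, hhalf]
    · intro t ht
      obtain ⟨h1, h2⟩ := hψ t ht
      refine mul_le_mul_of_nonneg_left ?_ hκ
      have h3 := tan_half_mul_sin_ge (P.turningAngle_nonneg i) hθπ h1 h2
      have h4 : Real.sin (P.turningAngle i) = Real.tan (P.turningAngle i / 2) *
          (1 + Real.cos (P.turningAngle i)) := by
        refine mul_left_cancel₀ hr.ne' ?_
        rw [e1, hτ, mul_assoc]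
      rw [Real.cos_sub, h4]
      have h5 : 0 ≤ 1 + Real.cos (P.turningAngle i) := by
        linarith [Real.neg_one_le_cos (P.turningAngle i)]
      nlinarith [mul_le_mul_of_nonneg_left h3 h5]
    · intro t
      have hs' := hs.ne'
      simp only [arc, if_neg hi, midpoint_eq, cornerNormal, Real.cos_sub]
      congr 1
      match_scalars <;> field_simp
      ring

variable (P) in
/-- The point of the two half edges at `v_i` whose distance along the polygon from the midpoint
of the incoming edge is `σ`. -/
noncomputable def cornerPoint (i : ZMod n) (σ : ℝ) : E3 :=
  P.vertex i + (min (σ - P.dl / 2) 0 • P.edgeDir (i - 1) + max (σ - P.dl / 2) 0 • P.edgeDir i)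

theorem cornerPoint_mem_carrier {i : ZMod n} {σ : ℝ} (hσ : σ ∈ Set.Icc 0 P.dl) :
    P.cornerPoint i σ ∈ P.carrier := by
  have hd := P.dl_pos
  rw [carrier, Set.mem_iUnion]
  rcases le_total σ (P.dl / 2) with h | h
  · refine ⟨i - 1, ?_⟩
    rw [segment_eq_image']
    refine ⟨(σ + P.dl / 2) / P.dl, ⟨div_nonneg (by linarith [hσ.1]) hd.le,
      div_le_one_of_le₀ (by linarith) hd.le⟩, ?_⟩
    have hv := P.vertex_succ (i - 1)
    have hv' := hv
    rw [sub_add_cancel] at hv'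
    simp only
    rw [hv, cornerPoint, min_eq_left (by linarith), max_eq_right (by linarith), hv',
      add_sub_cancel_left, smul_smul, div_mul_cancel₀ _ hd.ne']
    module
  · refine ⟨i, ?_⟩
    rw [segment_eq_image']
    refine ⟨(σ - P.dl / 2) / P.dl, ⟨div_nonneg (by linarith) hd.le,
      div_le_one_of_le₀ (by linarith [hσ.2]) hd.le⟩, ?_⟩
    simp only
    rw [P.vertex_succ, cornerPoint, min_eq_right (by linarith), max_eq_left (by linarith),
      add_sub_cancel_left, smul_smul, div_mul_cancel₀ _ hd.ne']
    module

theorem exists_cornerPoint_eq {x : E3} (hx : x ∈ P.carrier) :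
    ∃ i, ∃ σ ∈ Set.Icc 0 P.dl, P.cornerPoint i σ = x := by
  have hd := P.dl_pos
  rw [carrier, Set.mem_iUnion] at hx
  obtain ⟨i, hx⟩ := hx
  rw [segment_eq_image'] at hx
  obtain ⟨c, ⟨hc0, hc1⟩, rfl⟩ := hx
  simp only
  rw [P.vertex_succ, add_sub_cancel_left, smul_smul]
  have h0 : 0 ≤ c * P.dl := mul_nonneg hc0 hd.le
  have h1 : c * P.dl ≤ P.dl := mul_le_of_le_one_left hd.le hc1
  rcases le_total (c * P.dl) (P.dl / 2) with h | h
  · refine ⟨i, P.dl / 2 + c * P.dl, ⟨by linarith, by linarith⟩, ?_⟩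
    rw [cornerPoint, min_eq_right (by linarith), max_eq_left (by linarith)]
    module
  · refine ⟨i + 1, c * P.dl - P.dl / 2, ⟨by linarith, by linarith⟩, ?_⟩
    rw [cornerPoint, min_eq_left (by linarith), max_eq_right (by linarith), P.vertex_succ,
      add_sub_cancel_right]
    module

theorem range_inscribed (hP : P.dl / Real.sqrt 2 < P.sphereThickness) :
    Set.range P.inscribed = {x | ∃ i, ∃ t ∈ Set.Icc 0 (P.arcLength i), P.arc i t = x} := by
  ext x
  constructor
  · rintro ⟨s, rfl⟩
    obtain ⟨N, k, h1, h2⟩ := exists_shift_mem_piece hP s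
    refine ⟨k, s + N * P.period - P.arcStart k, ⟨by linarith, ?_⟩, ?_⟩
    · rw [arcStart_succ] at h2
      linarith
    · rw [← inscribed_eq hP ⟨h1, h2.le⟩, (inscribed_periodic hP).nat_mul N]
  · rintro ⟨i, t, ht, rfl⟩
    refine ⟨P.arcStart i.val + t, ?_⟩
    have hi : ((i.val : ℕ) : ZMod n) = i := ZMod.natCast_zmod_val i
    rw [inscribed_eq hP (k := i.val), add_sub_cancel_left, hi]
    rw [arcStart_succ, hi]
    exact ⟨by linarith [ht.1], by linarith [ht.2]⟩

/-! ### Distances between vertices -/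

theorem angle_edgeDir_add_le (i : ZMod n) (d : ℕ) :
    InnerProductGeometry.angle (P.edgeDir i) (P.edgeDir (i + d)) ≤ d * P.maxTurningAngle := by
  induction d with
  | zero =>
    have h : P.edgeDir i ≠ 0 := norm_ne_zero_iff.1 (by rw [norm_edgeDir]; exact one_ne_zero)
    simp [InnerProductGeometry.angle_self h]
  | succ d ih =>
    have h := P.angle_edgeDir (i + (d + 1 : ℕ))
    have h' := P.turningAngle_le_max (i + (d + 1 : ℕ))
    rw [show i + ((d + 1 : ℕ) : ZMod n) - 1 = i + d by push_cast; ring] at h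
    refine (InnerProductGeometry.angle_le_angle_add_angle _ (P.edgeDir (i + d)) _).trans ?_
    rw [h]
    push_cast at h' ⊢
    linarith

theorem vertex_add_natCast (i : ZMod n) (d : ℕ) :
    P.vertex (i + d) = P.vertex i + P.dl • ∑ k ∈ Finset.range d, P.edgeDir (i + k) := by
  induction d with
  | zero => simp
  | succ d ih =>
    rw [Finset.sum_range_succ, Nat.cast_succ, ← add_assoc, P.vertex_succ, ih, smul_add, add_assoc]

/-- Since `x ≤ tan x`, the hypothesis bounds the total turning `d θ_max` by `π`. Each of the `d`
edges then makes an acute angle with the middle one, onto which the path is projected. -/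
theorem dl_lt_dist_vertex_add (hP : P.dl / Real.sqrt 2 < P.sphereThickness) (i : ZMod n) {d : ℕ}
    (hd : 2 ≤ d) (h : ((d : ℝ) + 1) * P.dl < Real.pi * P.minRad) :
    P.dl < dist (P.vertex (i + d)) (P.vertex i) := by
  have hdl := P.dl_pos
  have hθ0 := P.maxTurningAngle_nonneg
  have hturn : (d : ℝ) * P.maxTurningAngle < Real.pi := by
    have hT := (tan_half_maxTurningAngle hP).1
    have h1 := Real.le_tan (x := P.maxTurningAngle / 2) (by linarith)
      (by linarith [maxTurningAngle_lt hP, Real.pi_pos])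
    rw [minRad, mul_div_assoc', lt_div_iff₀ (by positivity)] at h
    have h2 : ((d : ℝ) + 1) * (2 * Real.tan (P.maxTurningAngle / 2)) < Real.pi := by
      refine lt_of_mul_lt_mul_right (a := P.dl) ?_ hdl.le
      linarith
    have hd0 : (0 : ℝ) ≤ d := Nat.cast_nonneg d
    nlinarith [mul_le_mul_of_nonneg_left h1 hd0]
  have hpos : ∀ a b : ℕ, 2 * b ≤ d → 0 < ⟪P.edgeDir (i + a), P.edgeDir (i + a + b)⟫ := by
    intro a b hb
    have h1 := angle_edgeDir_add_le (P := P) (i + a) b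
    have h2 : (b : ℝ) * P.maxTurningAngle < Real.pi / 2 := by
      have h3 : (2 * b : ℝ) ≤ d := by exact_mod_cast hb
      linarith [mul_le_mul_of_nonneg_right h3 hθ0]
    have h3 : 0 < Real.cos (InnerProductGeometry.angle (P.edgeDir (i + a)) (P.edgeDir (i + a + b))) :=
      Real.cos_pos_of_mem_Ioo ⟨(neg_lt_zero.2 (half_pos Real.pi_pos)).trans_le
        (InnerProductGeometry.angle_nonneg _ _), h1.trans_lt h2⟩
    rwa [InnerProductGeometry.cos_angle, norm_edgeDir, norm_edgeDir, mul_one, div_one] at h3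
  set m := d / 2 with hm
  have hterm : ∀ k ∈ Finset.range d, 0 < ⟪P.edgeDir (i + k), P.edgeDir (i + m)⟫ := by
    intro k hk
    rw [Finset.mem_range] at hk
    rcases le_total k m with hkm | hkm
    · have h1 := hpos k (m - k) (by omega)
      rwa [add_assoc, ← Nat.cast_add, Nat.add_sub_cancel' hkm] at h1
    · have h1 := hpos m (k - m) (by omega)
      rwa [add_assoc, ← Nat.cast_add, Nat.add_sub_cancel' hkm, real_inner_comm] at h1
  -- The middle edge contributes `1`; as `d ≥ 2`, edge `0` is another one and contributes a positive
  -- amount.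
  have hsum : 1 < ∑ k ∈ Finset.range d, ⟪P.edgeDir (i + k), P.edgeDir (i + m)⟫ := by
    rw [← Finset.add_sum_erase _ _ (Finset.mem_range.2 (by omega : m < d)), inner_edgeDir_self]
    refine lt_add_of_pos_right _ (Finset.sum_pos (fun k hk => hterm k (Finset.mem_of_mem_erase hk))
      ⟨0, ?_⟩)
    rw [Finset.mem_erase, Finset.mem_range]
    omega
  have h1 := real_inner_le_norm (P.vertex (i + d) - P.vertex i) (P.edgeDir (i + m))
  rw [norm_edgeDir, mul_one, vertex_add_natCast, add_sub_cancel_left, inner_smul_left, sum_inner,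
    conj_trivial] at h1
  rw [dist_eq_norm, vertex_add_natCast, add_sub_cancel_left]
  nlinarith

theorem dl_lt_dist_vertex (hP : P.dl / Real.sqrt 2 < P.sphereThickness) {i j : ZMod n}
    (h0 : i ≠ j) (h1 : i ≠ j + 1) (h2 : j ≠ i + 1) :
    P.dl < dist (P.vertex i) (P.vertex j) := by
  rcases le_or_gt ⌈Real.pi * P.minRad / P.dl - 1⌉ (indexDist i j : ℤ) with h | h
  · refine lt_of_lt_of_le ?_ (two_mul_sphereThickness_le_dist h)
    refine lt_of_pow_lt_pow_left₀ 2 (mul_nonneg two_pos.le (sphereThickness_pos hP).le) ?_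
    nlinarith [sq_dl_lt hP, P.dl_pos]
  · have h3 := succ_indexDist_mul_dl_lt h
    have h4 : i = j + (indexDist i j : ZMod n) ∨ j = i + (indexDist i j : ZMod n) := by
      have h5 := ZMod.coe_valMinAbs (i - j)
      rcases Int.natAbs_eq (i - j).valMinAbs with h6 | h6
      · left
        rw [h6, Int.cast_natCast] at h5
        rw [indexDist, h5, add_sub_cancel]
      · right
        rw [h6, Int.cast_neg, Int.cast_natCast] at h5
        rw [indexDist, ← neg_neg ((i - j).valMinAbs.natAbs : ZMod n), h5]
        abel
    generalize indexDist i j = d at h3 h4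
    have hd : 2 ≤ d := by
      by_contra! hlt
      interval_cases d
      · simp only [Nat.cast_zero, add_zero] at h4
        exact h4.elim h0 fun h => h0 h.symm
      · simp only [Nat.cast_one] at h4
        exact h4.elim h1 h2
    rcases h4 with rfl | rfl
    · exact dl_lt_dist_vertex_add hP j hd h3
    · rw [dist_comm]
      exact dl_lt_dist_vertex_add hP i hd h3

theorem exists_dl_add_le_dist_vertex (hP : P.dl / Real.sqrt 2 < P.sphereThickness) :
    ∃ δ : ℝ, 0 < δ ∧ ∀ i j : ZMod n, i ≠ j → i ≠ j + 1 → j ≠ i + 1 →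
      P.dl + δ ≤ dist (P.vertex i) (P.vertex j) := by
  classical
  -- The value `1` on excluded pairs keeps the minimum positive, even if no pair is admissible.
  let g : ZMod n × ZMod n → ℝ := fun p =>
    if p.1 ≠ p.2 ∧ p.1 ≠ p.2 + 1 ∧ p.2 ≠ p.1 + 1 then
      dist (P.vertex p.1) (P.vertex p.2) - P.dl else 1
  obtain ⟨p, hp⟩ := Finite.exists_min g
  refine ⟨g p, ?_, fun i j h0 h1 h2 => ?_⟩
  · by_cases h : p.1 ≠ p.2 ∧ p.1 ≠ p.2 + 1 ∧ p.2 ≠ p.1 + 1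
    · simp only [g, if_pos h]
      exact sub_pos.2 (dl_lt_dist_vertex hP h.1 h.2.1 h.2.2)
    · simp only [g, if_neg h]
      exact one_pos
  · have h3 := hp (i, j)
    simp only [g] at h3 ⊢
    rw [if_pos (c := i ≠ j ∧ i ≠ j + 1 ∧ j ≠ i + 1) ⟨h0, h1, h2⟩] at h3
    linarith

/-! ### The isotopy from the polygon to the inscribed curve -/

variable (P) in
/-- The point with coordinates `(a, b)` with respect to the two edge directions at `v_i`, the
origin being the midpoint of the incoming edge. -/
noncomputable def cornerCoord (i : ZMod n) (a b : ℝ) : E3 :=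
  P.vertex i - (P.dl / 2) • P.edgeDir (i - 1) + (a • P.edgeDir (i - 1) + b • P.edgeDir i)

theorem cornerCoord_eq_cornerPoint (i : ZMod n) (a b : ℝ) :
    P.cornerCoord i (a + min b (P.dl / 2 - a)) (b - min b (P.dl / 2 - a)) =
      P.cornerPoint i (a + b) := by
  rw [cornerCoord, cornerPoint]
  rcases le_total b (P.dl / 2 - a) with h | h
  · rw [min_eq_left h, min_eq_left (by linarith), max_eq_right (by linarith)]
    module
  · rw [min_eq_right h, min_eq_right (by linarith), max_eq_left (by linarith)]
    module

theorem cornerCoord_end_eq (i : ZMod n) :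
    P.cornerCoord i (P.dl / 2) (P.dl / 2) = P.cornerCoord (i + 1) 0 0 := by
  rw [cornerCoord, cornerCoord, P.vertex_succ, add_sub_cancel_right]
  module

theorem norm_cornerCoord_sub_start_le (hP : P.dl / Real.sqrt 2 < P.sphereThickness) (i : ZMod n)
    {a b : ℝ} (hb : 0 ≤ b) (hba : b ≤ a) :
    ‖P.cornerCoord i a b - P.cornerCoord i 0 0‖ ≤
      2 * ⟪P.cornerCoord i a b - P.cornerCoord i 0 0, P.edgeDir (i - 1)⟫ := by
  have h : P.cornerCoord i a b - P.cornerCoord i 0 0 =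
      a • P.edgeDir (i - 1) + b • P.edgeDir i := by
    rw [cornerCoord, cornerCoord]
    module
  rw [h]
  exact norm_le_two_mul_inner (P.norm_edgeDir _) (P.norm_edgeDir _)
    (by rw [inner_edgeDir]; exact (cos_turningAngle_pos hP i).le) hb hba

theorem norm_end_sub_cornerCoord_le (hP : P.dl / Real.sqrt 2 < P.sphereThickness) (i : ZMod n)
    {a b : ℝ} (ha : a ≤ P.dl / 2) (hba : b ≤ a) :
    ‖P.cornerCoord i (P.dl / 2) (P.dl / 2) - P.cornerCoord i a b‖ ≤
      2 * ⟪P.cornerCoord i (P.dl / 2) (P.dl / 2) - P.cornerCoord i a b, P.edgeDir i⟫ := by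
  have h : P.cornerCoord i (P.dl / 2) (P.dl / 2) - P.cornerCoord i a b =
      (P.dl / 2 - b) • P.edgeDir i + (P.dl / 2 - a) • P.edgeDir (i - 1) := by
    rw [cornerCoord, cornerCoord]
    module
  rw [h]
  exact norm_le_two_mul_inner (P.norm_edgeDir _) (P.norm_edgeDir _)
    (by rw [real_inner_comm, inner_edgeDir]; exact (cos_turningAngle_pos hP i).le)
    (by linarith) (by linarith)

theorem dist_cornerCoord_vertex_le (i : ZMod n) {a b : ℝ} (ha : a ≤ P.dl / 2) (hb : 0 ≤ b)
    (hba : b ≤ a) : dist (P.cornerCoord i a b) (P.vertex i) ≤ P.dl / 2 := by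
  have h : P.cornerCoord i a b - P.vertex i =
      b • P.edgeDir i - (P.dl / 2 - a) • P.edgeDir (i - 1) := by
    rw [cornerCoord]
    module
  rw [dist_eq_norm, h]
  refine (norm_sub_le _ _).trans ?_
  rw [norm_smul, norm_smul, norm_edgeDir, norm_edgeDir, Real.norm_of_nonneg hb,
    Real.norm_of_nonneg (by linarith)]
  linarith

theorem ambientIsotopic_inscribed (hP : P.dl / Real.sqrt 2 < P.sphereThickness) :
    AmbientIsotopic P.carrier (Set.range P.inscribed) := by
  have hdl := P.dl_pos
  choose α β hαm hβm hαc hβc hα0 hβ0 hαℓ hβℓ hβα harc using exists_corner_coordinates hP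
  obtain ⟨δ, hδ, hdist⟩ := exists_dl_add_le_dist_vertex hP
  -- Moving `h` from the second coordinate to the first stops when the second is `0` or the first is
  -- `dl / 2`, that is, on a half edge. Thus `Y 1` is the polygon, `Y 0` the arc, and `q` the
  -- displacement from `Y 1` to `Y 0`.
  let h : ZMod n → ℝ → ℝ := fun i t => min (β i t) (P.dl / 2 - α i t)
  let q : ZMod n → ℝ → E3 := fun i t => h i t • (P.edgeDir i - P.edgeDir (i - 1))
  let Y : ℝ → ZMod n → ℝ → E3 := fun μ i t =>
    P.cornerCoord i (α i t + μ * h i t) (β i t - μ * h i t)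
  have hβ_nonneg : ∀ i, ∀ t ∈ Set.Icc 0 (P.arcLength i), 0 ≤ β i t := fun i t ht => by
    rw [← hβ0 i]
    exact hβm i (Set.left_mem_Icc.2 (arcLength_pos hP i).le) ht ht.1
  have hα_le : ∀ i, ∀ t ∈ Set.Icc 0 (P.arcLength i), α i t ≤ P.dl / 2 := fun i t ht => by
    rw [← hαℓ i]
    exact hαm i ht (Set.right_mem_Icc.2 (arcLength_pos hP i).le) ht.2
  have hh0 : ∀ i, ∀ t ∈ Set.Icc 0 (P.arcLength i), 0 ≤ h i t := fun i t ht =>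
    le_min (hβ_nonneg i t ht) (sub_nonneg.2 (hα_le i t ht))
  have hmem : ∀ μ ∈ Set.Icc (0 : ℝ) 1, ∀ i, ∀ t ∈ Set.Icc 0 (P.arcLength i),
      α i t + μ * h i t ≤ P.dl / 2 ∧ 0 ≤ β i t - μ * h i t ∧
        β i t - μ * h i t ≤ α i t + μ * h i t := by
    intro μ hμ i t ht
    have h1 : h i t ≤ β i t := min_le_left _ _
    have h2 : h i t ≤ P.dl / 2 - α i t := min_le_right _ _
    have h3 : μ * h i t ≤ h i t := mul_le_of_le_one_left (hh0 i t ht) hμ.2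
    have h4 : 0 ≤ μ * h i t := mul_nonneg hμ.1 (hh0 i t ht)
    exact ⟨by linarith, by linarith, by linarith [hβα i t ht]⟩
  have hq0 : ∀ i, q i 0 = 0 := fun i => by
    simp only [q, h, hα0, hβ0, sub_zero, min_eq_left (half_pos hdl).le, zero_smul]
  have hqℓ : ∀ i, q i (P.arcLength i) = 0 := fun i => by
    simp only [q, h, hαℓ, hβℓ, sub_self, min_eq_right (half_pos hdl).le, zero_smul]
  have hY0 : ∀ μ i, Y μ i 0 = P.cornerCoord i 0 0 := fun μ i => by
    simp only [Y, h, hα0, hβ0, sub_zero, min_eq_left (half_pos hdl).le, mul_zero, add_zero]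
  have hYℓ : ∀ μ i, Y μ i (P.arcLength i) = P.cornerCoord i (P.dl / 2) (P.dl / 2) := fun μ i => by
    simp only [Y, h, hαℓ, hβℓ, sub_self, min_eq_right (half_pos hdl).le, mul_zero, add_zero,
      sub_zero]
  have hsame : ∀ μ i, ∀ t ∈ Set.Icc 0 (P.arcLength i), ∀ t' ∈ Set.Icc 0 (P.arcLength i),
      ‖q i t - q i t'‖ ≤ 4 * ‖Y μ i t - Y μ i t'‖ := by
    intro μ i t ht t' ht'
    have h1 : 0 ≤ (α i t - α i t') * (β i t - β i t') := by
      rcases le_total t t' with hle | hle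
      · exact mul_nonneg_of_nonpos_of_nonpos (sub_nonpos.2 (hαm i ht ht' hle))
          (sub_nonpos.2 (hβm i ht ht' hle))
      · exact mul_nonneg (sub_nonneg.2 (hαm i ht' ht hle)) (sub_nonneg.2 (hβm i ht' ht hle))
    have h2 := norm_corner_displacement_sub_le (τ := P.dl / 2) (P.norm_edgeDir (i - 1))
      (P.norm_edgeDir i) (by rw [inner_edgeDir]; exact (cos_turningAngle_pos hP i).le) h1 μ
    simp only [Y, cornerCoord]
    rw [add_sub_add_left_eq_sub]
    exact h2
  have hadj : ∀ μ ∈ Set.Icc (0 : ℝ) 1, ∀ i, ∀ t ∈ Set.Icc 0 (P.arcLength i),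
      ∀ t' ∈ Set.Icc 0 (P.arcLength (i + 1)),
      ‖q i t - q (i + 1) t'‖ ≤ 8 * ‖Y μ i t - Y μ (i + 1) t'‖ := by
    intro μ hμ i t ht t' ht'
    obtain ⟨b1, b2, b3⟩ := hmem μ hμ i t ht
    obtain ⟨c1, c2, c3⟩ := hmem μ hμ (i + 1) t' ht'
    have h1 := hsame μ i _ (Set.right_mem_Icc.2 (arcLength_pos hP i).le) t ht
    have h2 := hsame μ (i + 1) t' ht' 0 (Set.left_mem_Icc.2 (arcLength_pos hP (i + 1)).le)
    rw [hqℓ, zero_sub, norm_neg, hYℓ] at h1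
    rw [hq0, sub_zero, hY0, ← cornerCoord_end_eq] at h2
    have h3 : ‖P.cornerCoord i (P.dl / 2) (P.dl / 2) - Y μ i t‖ ≤ _ :=
      norm_end_sub_cornerCoord_le hP i b1 b3
    have h4 : ‖Y μ (i + 1) t' - P.cornerCoord (i + 1) 0 0‖ ≤ _ :=
      norm_cornerCoord_sub_start_le hP (i + 1) c2 c3
    rw [← cornerCoord_end_eq, add_sub_cancel_right] at h4
    -- On either side of the common midpoint, `q` is at most `4 · 2` times the distance to it along
    -- the shared edge direction, and these two projections add up.
    have h5 := real_inner_le_norm (Y μ (i + 1) t' - Y μ i t) (P.edgeDir i)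
    rw [norm_edgeDir, mul_one, ← sub_add_sub_cancel _ (P.cornerCoord i (P.dl / 2) (P.dl / 2)),
      inner_add_left, sub_add_sub_cancel, norm_sub_rev] at h5
    have h6 := norm_sub_le (q i t) (q (i + 1) t')
    linarith
  have hfar : ∀ μ ∈ Set.Icc (0 : ℝ) 1, ∀ i j, i ≠ j → i ≠ j + 1 → j ≠ i + 1 →
      ∀ t ∈ Set.Icc 0 (P.arcLength i), ∀ t' ∈ Set.Icc 0 (P.arcLength j),
      ‖q i t - q j t'‖ ≤ 2 * P.dl / δ * ‖Y μ i t - Y μ j t'‖ := by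
    intro μ hμ i j hij hij1 hji1 t ht t' ht'
    have hq : ∀ k, ∀ u ∈ Set.Icc 0 (P.arcLength k), ‖q k u‖ ≤ P.dl := by
      intro k u hu
      have h1 := norm_smul_sub_le_of_unit (P.norm_edgeDir (k - 1)) (P.norm_edgeDir k) (h k u)
      rw [abs_of_nonneg (hh0 k u hu)] at h1
      have h2 : h k u ≤ P.dl / 2 - α k u := min_le_right _ _
      refine h1.trans ?_
      linarith [hβ_nonneg k u hu, hβα k u hu]
    have hv : ∀ k, ∀ u ∈ Set.Icc 0 (P.arcLength k), dist (Y μ k u) (P.vertex k) ≤ P.dl / 2 := by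
      intro k u hu
      obtain ⟨b1, b2, b3⟩ := hmem μ hμ k u hu
      exact dist_cornerCoord_vertex_le k b1 b2 b3
    have h1 := hdist i j hij hij1 hji1
    have h2 := dist_triangle4 (P.vertex i) (Y μ i t) (Y μ j t') (P.vertex j)
    have h3 := hv i t ht
    rw [dist_comm] at h3
    have h4 := hv j t' ht'
    rw [← dist_eq_norm (Y μ i t)]
    have h5 : δ ≤ dist (Y μ i t) (Y μ j t') := by linarith
    have h6 := norm_sub_le (q i t) (q j t')
    rw [div_mul_eq_mul_div, le_div_iff₀ hδ]
    have h7 : ‖q i t - q j t'‖ ≤ 2 * P.dl := by linarith [hq i t ht, hq j t' ht']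
    exact mul_le_mul h7 h5 hδ.le (by linarith)
  let ι := {x : ZMod n × ℝ // x.2 ∈ Set.Icc 0 (P.arcLength x.1)}
  have hYq : ∀ (c : ℝ) i t, Y 1 i t + c • q i t = Y (1 - c) i t := by
    intro c i t
    simp only [Y, q, cornerCoord]
    module
  have hK : 0 ≤ 8 + 2 * P.dl / δ := by positivity
  have hiso := AmbientIsotopic.of_linear_homotopy (ι := ι) (X := fun x => Y 1 x.1.1 x.1.2)
    (q := fun x => q x.1.1 x.1.2) (K := (8 + 2 * P.dl / δ).toNNReal) (by
      rintro c hc ⟨⟨i, t⟩, ht⟩ ⟨⟨j, t'⟩, ht'⟩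
      simp only [Real.coe_toNNReal _ hK, hYq] at ht ht' ⊢
      have hμ : 1 - c ∈ Set.Icc (0 : ℝ) 1 := ⟨by linarith [hc.2], by linarith [hc.1]⟩
      have hpos : 0 ≤ 2 * P.dl / δ := by positivity
      have hN := norm_nonneg (Y (1 - c) i t - Y (1 - c) j t')
      have hprod := mul_nonneg hpos hN
      rw [add_mul]
      by_cases h0 : i = j
      · subst h0
        linarith [hsame (1 - c) i t ht t' ht']
      by_cases h1 : i = j + 1
      · subst h1
        have := hadj (1 - c) hμ j t' ht' t ht
        rw [norm_sub_rev, norm_sub_rev (Y _ _ _)] at this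
        linarith
      by_cases h2 : j = i + 1
      · subst h2
        linarith [hadj (1 - c) hμ i t ht t' ht']
      linarith [hfar (1 - c) hμ i j h0 h1 h2 t ht t' ht'])
  have hY1 : ∀ i t, Y 1 i t = P.cornerPoint i (α i t + β i t) := fun i t => by
    simp only [Y, one_mul]
    exact cornerCoord_eq_cornerPoint i _ _
  have hX : Set.range (fun x : ι => Y 1 x.1.1 x.1.2) = P.carrier := by
    ext x
    constructor
    · rintro ⟨⟨⟨i, t⟩, ht⟩, rfl⟩
      change Y 1 i t ∈ _
      rw [hY1]
      exact cornerPoint_mem_carrier ⟨by linarith [hβ_nonneg i t ht, hβα i t ht],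
        by linarith [hα_le i t ht, hβα i t ht]⟩
    · intro hx
      obtain ⟨i, σ, hσ, rfl⟩ := exists_cornerPoint_eq hx
      -- The coordinate sum runs continuously from `0` to `dl`, so every point of the two half edges
      -- is reached.
      have hivt := intermediate_value_Icc (arcLength_pos hP i).le
        ((hαc i).add (hβc i)).continuousOn
      obtain ⟨t, ht, hσt⟩ := hivt (by simpa [hα0, hβ0, hαℓ, hβℓ] using hσ)
      exact ⟨⟨(i, t), ht⟩, (hY1 i t).trans (congrArg _ hσt)⟩
  have hXq : Set.range (fun x : ι => Y 1 x.1.1 x.1.2 + q x.1.1 x.1.2) =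
      Set.range P.inscribed := by
    have hA : ∀ i t, Y 1 i t + q i t = P.arc i t := fun i t => by
      rw [harc, ← one_smul ℝ (q i t), hYq]
      simp only [Y, sub_self, zero_mul, add_zero, sub_zero, cornerCoord]
    rw [range_inscribed hP]
    ext x
    constructor
    · rintro ⟨⟨⟨i, t⟩, ht⟩, rfl⟩
      exact ⟨i, t, ht, (hA i t).symm⟩
    · rintro ⟨i, t, ht, rfl⟩
      exact ⟨⟨(i, t), ht⟩, hA i t⟩
  rwa [hX, hXq] at hiso

end EquilateralKnot

end Ropelength

theorem mainTheorem1 {n : ℕ} [NeZero n] (P : Ropelength.EquilateralKnot n)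
    (hP : P.dl / Real.sqrt 2 < P.sphereThickness) :
    Ropelength.IsC11Knot P.inscribed P.period ∧
    ENNReal.ofReal P.circleRadius ≤ Ropelength.thickness P.inscribed P.period ∧
    Ropelength.AmbientIsotopic P.carrier (Set.range P.inscribed) ∧
    Ropelength.ropelength P.inscribed P.period ≤
      ENNReal.ofReal (Ropelength.length P.inscribed P.period / P.circleRadius) ∧
    Ropelength.minRopelength P.carrier ≤
      ENNReal.ofReal (Ropelength.length P.inscribed P.period / P.circleRadius) := by
  have h1 := Ropelength.EquilateralKnot.isC11Knot_inscribed hP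
  have h2 := Ropelength.EquilateralKnot.ambientIsotopic_inscribed hP
  have h3 := Ropelength.EquilateralKnot.ropelength_inscribed_le hP
  exact ⟨h1, Ropelength.EquilateralKnot.circleRadius_le_thickness hP, h2, h3,
    le_trans (sInf_le ⟨P.inscribed, P.period, h1.1, h2, rfl⟩) h3⟩
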